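/- Consider three parties, Alice, Bob and Charlie, each with two measurement settings $x,y,z\in\{0,1\}$ and two outcomes $a,b,c\in\{0,1\}$. A point is a real vector $P=(P(abc|xyz))\in\mathbb{R}^{64}$. Outcome $0$ has value $+1$ and outcome $1$ has value $-1$, so that $\langle A_xB_yC_z\rangle=\sum_{abc}(-1)^{a+b+c}P(abc|xyz)$. The one- and two-body expectation values of a no-signalling point are defined in the same way from its marginals, and a normalised no-signalling point is determined by its one-, two- and three-body expectation values. Let $\mathcal L$ be the convex hull of the deterministic points and $\mathcal{NS}$ the set of nonnegative, normalised, no-signalling points. Let $\mathcal Q$ be the closure of the set of all points of the form $P(abc|xyz)=\operatorname{tr}[(E^x_a\otimes F^y_b\otimes G^z_c)\rho]$, where $\rho$ is a state (positive semidefinite, unit trace) on $(\mathbb C^d)^{\otimes 3}$, $d<\infty$ is arbitrary, and $\{E^x_a\}_a,\{F^y_b\}_b,\{G^z_c\}_c$ are measurements on $\mathbb C^d$ (positive semidefinite operators summing to the identity). Let $$B_8\cdot P=\langle A_0B_0C_0\rangle+\langle A_0B_1C_1\rangle+\langle A_1B_0C_0\rangle-\langle A_1B_1C_1\rangle ,$$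 and for $\mathcal S=\mathcal L,\mathcal Q,\mathcal{NS}$ let $\beta_{\mathcal S}$ be the maximum of $B_8\cdot P$ over $P\in\mathcal S$. Let $P_1,\dots,P_4$ be the points with $\langle A_x\rangle=\langle B_y\rangle=\langle A_xC_z\rangle=\langle B_yC_z\rangle=0$ for all $x,y,z$ and - $P_1$: $\langle C_z\rangle=1$ and $\langle A_xB_y\rangle=\langle A_xB_yC_z\rangle=(-1)^{xy}/\sqrt2$; - $P_2$: $\langle C_z\rangle=-1$ and $-\langle A_xB_y\rangle=\langle A_xB_yC_z\rangle=(-1)^{xy}/\sqrt2$; - $P_3$: $\langle C_0\rangle=1$, $\langle C_1\rangle=-1$, $\langle A_xB_y\rangle=(-1)^{(x+1)y}/\sqrt2$ and $\langle A_xB_yC_z\rangle=(-1)^{(x+1)y+z}/\sqrt2$; - $P_4$: $\langle C_0\rangle=-1$, $\langle C_1\rangle=1$, $\langle A_xB_y\rangle=(-1)^{(x+1)y+1}/\sqrt2$ and $\langle A_xB_yC_z\rangle=(-1)^{(x+1)y+z}/\sqrt2$. Let $P_5,\dots,P_8$ be obtained from $P_1,\dots,P_4$ by exchanging the roles of Bob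 and Charlie. For $\alpha\in[0,2\pi]$ let $R_\alpha$ be the point whose one- and two-body expectation values all vanish and whose three-body expectation values are $$\begin{aligned} \langle A_0B_0C_0\rangle&=\langle A_0B_1C_1\rangle=\tfrac1{\sqrt2}, & \langle A_0B_0C_1\rangle&=\langle A_0B_1C_0\rangle=\cos\alpha,\\ \langle A_1B_0C_0\rangle&=-\langle A_1B_1C_1\rangle=\tfrac1{\sqrt2}, & \langle A_1B_0C_1\rangle&=-\langle A_1B_1C_0\rangle=\sin\alpha . \end{aligned}$$ Then the three maxima exist and $\beta_{\mathcal L}=2$, $\beta_{\mathcal Q}=2\sqrt2$, $\beta_{\mathcal{NS}}=4$, and the quantum face is $$\{P\in\mathcal Q : B_8\cdot P=\beta_{\mathcal Q}\}=\operatorname{conv}\big(\{P_1,\dots,P_8\}\cup\{R_\alpha:\alpha\in[0,2\pi]\}\big).$$ Moreover, every $R_\alpha$ is generated by local two-outcome measurements on the three-qubit GHZ state $(|000\rangle+|111\rangle)/\sqrt2$. -/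

import Mathlib

open scoped ComplexOrder Kronecker

noncomputable section

namespace Tripartite

/-- A point `P` of the three-party scenario with two settings and two outcomes per party:
`P a b c x y z` is the number `P(abc|xyz)`, with outcomes `a b c` and settings `x y z`. -/
abbrev Behaviour : Type := Fin 2 → Fin 2 → Fin 2 → Fin 2 → Fin 2 → Fin 2 → ℝ

/-- The `±1` value of an outcome: `0 ↦ 1` and `1 ↦ -1`. -/
def sgn (a : Fin 2) : ℝ := (-1) ^ (a : ℕ)

/-- The three-body expectation value `⟨A_x B_y C_z⟩`. -/
def corr (P : Behaviour) (x y z : Fin 2) : ℝ :=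
  ∑ a, ∑ b, ∑ c, sgn a * sgn b * sgn c * P a b c x y z

/-- The value `B₈ ⬝ P = ⟨A₀B₀C₀⟩ + ⟨A₀B₁C₁⟩ + ⟨A₁B₀C₀⟩ - ⟨A₁B₁C₁⟩`. -/
def bellB8 (P : Behaviour) : ℝ :=
  corr P 0 0 0 + corr P 0 1 1 + corr P 1 0 0 - corr P 1 1 1

/-! The three correlation sets -/

/-- Every party's outcome is a function of that party's setting. -/
def IsDeterministic (P : Behaviour) : Prop :=
  ∃ f g h : Fin 2 → Fin 2, ∀ a b c x y z,
    P a b c x y z = if a = f x ∧ b = g y ∧ c = h z then 1 else 0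

/-- The local set. -/
def localSet : Set Behaviour := convexHull ℝ {P | IsDeterministic P}

/-- The no-signalling set: nonnegative and normalised, and for each party the joint outcome
distribution of the other two does not depend on that party's setting. (By iteration, the
marginal of each single party does not depend on the settings of the other two.) -/
def noSignallingSet : Set Behaviour :=
  {P | (∀ a b c x y z, 0 ≤ P a b c x y z) ∧
    (∀ x y z, ∑ a, ∑ b, ∑ c, P a b c x y z = 1) ∧
    (∀ b c x x' y z, ∑ a, P a b c x y z = ∑ a, P a b c x' y z) ∧
    (∀ a c x y y' z, ∑ b, P a b c x y z = ∑ b, P a b c x y' z) ∧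
    (∀ a b x y z z', ∑ c, P a b c x y z = ∑ c, P a b c x y z')}

/-- A two-outcome measurement on `ℂ^d`: positive semidefinite operators summing to `1`. -/
def IsMeasurement {d : ℕ} (E : Fin 2 → Matrix (Fin d) (Fin d) ℂ) : Prop :=
  (∀ a, (E a).PosSemidef) ∧ ∑ a, E a = 1

/-- `P` is generated by the state `ρ` on `ℂ^d ⊗ ℂ^d ⊗ ℂ^d` and the local measurements
`E x`, `F y`, `G z`, that is, `P(abc|xyz) = tr[(E x a ⊗ F y b ⊗ G z c) ρ]`. -/
def Generates {d : ℕ} (ρ : Matrix (Fin d × Fin d × Fin d) (Fin d × Fin d × Fin d) ℂ)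
    (E F G : Fin 2 → Fin 2 → Matrix (Fin d) (Fin d) ℂ) (P : Behaviour) : Prop :=
  (ρ.PosSemidef ∧ ρ.trace = 1) ∧
  ((∀ x, IsMeasurement (E x)) ∧ (∀ y, IsMeasurement (F y)) ∧ (∀ z, IsMeasurement (G z))) ∧
  ∀ a b c x y z, (P a b c x y z : ℂ) = ((E x a ⊗ₖ (F y b ⊗ₖ G z c)) * ρ).trace

/-- Behaviours that finite-dimensional quantum systems generate. -/
def quantumFinite : Set Behaviour :=
  {P | ∃ (d : ℕ) (ρ : Matrix (Fin d × Fin d × Fin d) (Fin d × Fin d × Fin d) ℂ)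
    (E F G : Fin 2 → Fin 2 → Matrix (Fin d) (Fin d) ℂ), Generates ρ E F G P}

/-- The quantum set. -/
def quantumSet : Set Behaviour := closure quantumFinite

/-- `β_S`, the maximal value of the function `B` on `S`. -/
def maxValue (B : Behaviour → ℝ) (S : Set Behaviour) : ℝ := sSup (B '' S)

/-- The face `{P ∈ S | B ⬝ P = β_S}`. -/
def face (B : Behaviour → ℝ) (S : Set Behaviour) : Set Behaviour :=
  {P | P ∈ S ∧ B P = maxValue B S}

/-! Points given by their one-, two- and three-body expectation values -/

/-- The expectation values of a no-signalling point; for example `AC x z` is `⟨A_x C_z⟩`. -/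
structure Expectations where
  A : Fin 2 → ℝ
  B : Fin 2 → ℝ
  C : Fin 2 → ℝ
  AB : Fin 2 → Fin 2 → ℝ
  AC : Fin 2 → Fin 2 → ℝ
  BC : Fin 2 → Fin 2 → ℝ
  ABC : Fin 2 → Fin 2 → Fin 2 → ℝ

/-- The point with the given expectation values. -/
def Expectations.toBehaviour (K : Expectations) : Behaviour := fun a b c x y z =>
  (1 + sgn a * K.A x + sgn b * K.B y + sgn c * K.C z
    + sgn a * sgn b * K.AB x y + sgn a * sgn c * K.AC x z + sgn b * sgn c * K.BC y z
    + sgn a * sgn b * sgn c * K.ABC x y z) / 8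

/-- `P` is normalised and has the expectation values `K`; the one- and two-body ones are computed
with any settings of the remaining parties. -/
def HasExpectations (P : Behaviour) (K : Expectations) : Prop :=
  ∀ x y z, ∑ a, ∑ b, ∑ c, P a b c x y z = 1 ∧
    ∑ a, ∑ b, ∑ c, sgn a * P a b c x y z = K.A x ∧
    ∑ a, ∑ b, ∑ c, sgn b * P a b c x y z = K.B y ∧
    ∑ a, ∑ b, ∑ c, sgn c * P a b c x y z = K.C z ∧
    ∑ a, ∑ b, ∑ c, sgn a * sgn b * P a b c x y z = K.AB x y ∧
    ∑ a, ∑ b, ∑ c, sgn a * sgn c * P a b c x y z = K.AC x z ∧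
    ∑ a, ∑ b, ∑ c, sgn b * sgn c * P a b c x y z = K.BC y z ∧
    corr P x y z = K.ABC x y z

/-- The expectation values determine the point, and `toBehaviour` is that point. -/
theorem hasExpectations_iff (P : Behaviour) (K : Expectations) :
    HasExpectations P K ↔ P = K.toBehaviour := by
  constructor
  · intro h
    funext a b c x y z
    obtain ⟨h0, h1, h2, h3, h4, h5, h6, h7⟩ := h x y z
    simp only [corr, Fin.sum_univ_two, sgn, Fin.val_zero, Fin.val_one, pow_zero, pow_one]
      at h0 h1 h2 h3 h4 h5 h6 h7
    fin_cases a <;> fin_cases b <;> fin_cases c <;>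
      simp [Expectations.toBehaviour, sgn] <;> linarith
  · rintro rfl x y z
    refine ⟨?_, ?_, ?_, ?_, ?_, ?_, ?_, ?_⟩ <;>
      simp [corr, Expectations.toBehaviour, Fin.sum_univ_two, sgn] <;> ring

/-- The point with the roles of Bob and Charlie exchanged. -/
def swapBC (P : Behaviour) : Behaviour := fun a b c x y z => P a c b x z y

/-- Charlie always outputs `0`. -/
def point1 : Behaviour := Expectations.toBehaviour
  { A := fun _ => 0
    B := fun _ => 0
    C := fun _ => 1
    AB := fun x y => (-1) ^ (x * y : ℕ) / √2
    AC := fun _ _ => 0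
    BC := fun _ _ => 0
    ABC := fun x y _ => (-1) ^ (x * y : ℕ) / √2 }

/-- Charlie always outputs `1`. -/
def point2 : Behaviour := Expectations.toBehaviour
  { A := fun _ => 0
    B := fun _ => 0
    C := fun _ => -1
    AB := fun x y => -((-1) ^ (x * y : ℕ) / √2)
    AC := fun _ _ => 0
    BC := fun _ _ => 0
    ABC := fun x y _ => (-1) ^ (x * y : ℕ) / √2 }

/-- Charlie outputs his setting. -/
def point3 : Behaviour := Expectations.toBehaviour
  { A := fun _ => 0
    B := fun _ => 0
    C := ![1, -1]
    AB := fun x y => (-1) ^ ((x + 1) * y : ℕ) / √2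
    AC := fun _ _ => 0
    BC := fun _ _ => 0
    ABC := fun x y z => (-1) ^ ((x + 1) * y + z : ℕ) / √2 }

/-- Charlie outputs the opposite of his setting. -/
def point4 : Behaviour := Expectations.toBehaviour
  { A := fun _ => 0
    B := fun _ => 0
    C := ![-1, 1]
    AB := fun x y => (-1) ^ ((x + 1) * y + 1 : ℕ) / √2
    AC := fun _ _ => 0
    BC := fun _ _ => 0
    ABC := fun x y z => (-1) ^ ((x + 1) * y + z : ℕ) / √2 }

/-- The eight points `P₁, …, P₈` (indexed from `0`). -/
def points : Fin 8 → Behaviour :=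
  ![point1, point2, point3, point4, swapBC point1, swapBC point2, swapBC point3, swapBC point4]

/-- The one-parameter family; in `ABC` the successive indices are `x`, `y`, `z`. -/
def familyPoint (α : ℝ) : Behaviour := Expectations.toBehaviour
  { A := fun _ => 0
    B := fun _ => 0
    C := fun _ => 0
    AB := fun _ _ => 0
    AC := fun _ _ => 0
    BC := fun _ _ => 0
    ABC := ![![![1 / √2, Real.cos α], ![Real.cos α, 1 / √2]],
             ![![1 / √2, Real.sin α], ![-Real.sin α, -(1 / √2)]]] }

/-- The three-qubit vector `(|000⟩ + |111⟩) / √2`. -/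
def ghzVec : Fin 2 × Fin 2 × Fin 2 → ℂ := fun i =>
  if i = (0, 0, 0) ∨ i = (1, 1, 1) then ((1 / √2 : ℝ) : ℂ) else 0

/-- The projector onto `ghzVec`. -/
def ghzState : Matrix (Fin 2 × Fin 2 × Fin 2) (Fin 2 × Fin 2 × Fin 2) ℂ :=
  Matrix.vecMulVec ghzVec (star ghzVec)

end Tripartite

end

namespace Tripartite

noncomputable section

/-! Reduction to qubits. A dilation followed by Jordan's lemma (`exists_flip_decomposition`) turns a
pair of two-outcome measurements into a compression of a direct sum of qubit measurements, of
`flipObs 1` and `flipObs u` with |u| = 1. Hence every finite-dimensional behaviour is a convex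
combination of pure three-qubit behaviours of this kind (`quantumFinite_subset`). These form a
compact set, so their hull is closed and contains the closure as well (`quantumSet_subset`).

Bound. All observables flip the basis, so on qubits the Bell operator splits over the four planes
spanned by |0,j,k⟩ and |1,j+1,k+1⟩. If u is Alice's phase and ζ the product of Bob's and Charlie's
phases at j and k, the off-diagonal coefficient is (1+ζ)+u(1-ζ), of modulus at most |1+ζ|+|1-ζ| ≤
2√2. `block_sum_of_squares` writes the gap as a sum of squares.

Equality. A block in which the vector is nonzero forces ζ = u = ±i (`phase_eq_of_block`). Two blocks
that differ in both j and k cannot satisfy this together, so either one block survives or two that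
share Bob's or Charlie's index. A single block carries a GHZ-like vector and yields a point R_α. Two
blocks sharing Bob's index force Charlie's phase to be ±1: his two observables agree up to sign, and
the behaviour lies on the segment from P₁ to P₂ or from P₃ to P₄. Exchanging Bob and Charlie covers
the other case. `mem_convexHull_of_max` carries bound and maximisers from qubit strategies to their
hull.

Conversely, the same block vectors realise P₁, …, P₈, the GHZ state realises R_α, and direct sums
make the quantum set convex. The local bound is a check of the deterministic points; the
no-signalling bound only uses that correlators lie in [-1, 1]. -/

/-- The behaviour given by the Born rule. -/
def bornBehaviour {l m n : Type*} [Fintype l] [Fintype m] [Fintype n]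
    (ρ : Matrix (l × m × n) (l × m × n) ℂ)
    (E : Fin 2 → Fin 2 → Matrix l l ℂ) (F : Fin 2 → Fin 2 → Matrix m m ℂ)
    (G : Fin 2 → Fin 2 → Matrix n n ℂ) : Behaviour :=
  fun a b c x y z => ((E x a ⊗ₖ (F y b ⊗ₖ G z c)) * ρ).trace.re

/-! ### Qubit strategies with flip observables -/

/-- The qubit observable that exchanges the basis vectors, with phases `a` and `star a`. -/
def flipObs (a : ℂ) : Matrix (Fin 2) (Fin 2) ℂ := !![0, star a; a, 0]

/-- The effects of the measurements of the observables `flipObs (a x)`. -/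
def flipEffect (a : Fin 2 → ℂ) (x o : Fin 2) : Matrix (Fin 2) (Fin 2) ℂ :=
  (1 / 2 : ℂ) • (1 + (sgn o : ℂ) • flipObs (a x))

/-- The phase that `flipObs a` gives to the basis vector `i`. -/
def flipPhase (a : ℂ) (i : Fin 2) : ℂ := ![a, star a] i

/-- The expectation values of `flipObs (a x)`, `flipObs (b y)`, `flipObs (c z)` in `ψ`. -/
def qubitExp (a b c : Fin 2 → ℂ) (ψ : Fin 2 × Fin 2 × Fin 2 → ℂ) : Expectations where
  A x := (∑ i, ∑ j, ∑ k, flipPhase (a x) i * ψ (i, j, k) * star (ψ (i + 1, j, k))).re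
  B y := (∑ i, ∑ j, ∑ k, flipPhase (b y) j * ψ (i, j, k) * star (ψ (i, j + 1, k))).re
  C z := (∑ i, ∑ j, ∑ k, flipPhase (c z) k * ψ (i, j, k) * star (ψ (i, j, k + 1))).re
  AB x y := (∑ i, ∑ j, ∑ k, flipPhase (a x) i * flipPhase (b y) j *
    ψ (i, j, k) * star (ψ (i + 1, j + 1, k))).re
  AC x z := (∑ i, ∑ j, ∑ k, flipPhase (a x) i * flipPhase (c z) k *
    ψ (i, j, k) * star (ψ (i + 1, j, k + 1))).re
  BC y z := (∑ i, ∑ j, ∑ k, flipPhase (b y) j * flipPhase (c z) k *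
    ψ (i, j, k) * star (ψ (i, j + 1, k + 1))).re
  ABC x y z := (∑ i, ∑ j, ∑ k, flipPhase (a x) i * flipPhase (b y) j * flipPhase (c z) k *
    ψ (i, j, k) * star (ψ (i + 1, j + 1, k + 1))).re

/-- The behaviour of qubit measurements `flipEffect` in the vector `ψ`. -/
def qubitBehaviour (a b c : Fin 2 → ℂ) (ψ : Fin 2 × Fin 2 × Fin 2 → ℂ) : Behaviour :=
  bornBehaviour (Matrix.vecMulVec ψ (star ψ)) (flipEffect a) (flipEffect b) (flipEffect c)

theorem trace_kronecker_mul_vecMulVec (X Y Z : Matrix (Fin 2) (Fin 2) ℂ)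
    (ψ : Fin 2 × Fin 2 × Fin 2 → ℂ) :
    ((X ⊗ₖ (Y ⊗ₖ Z)) * Matrix.vecMulVec ψ (star ψ)).trace =
      ∑ i, ∑ j, ∑ k, ∑ i', ∑ j', ∑ k', X i i' * Y j j' * Z k k' * ψ (i', j', k') *
        star (ψ (i, j, k)) := by
  simp only [Matrix.trace, Matrix.diag, Matrix.mul_apply, Fintype.sum_prod_type,
    Matrix.kroneckerMap_apply, Matrix.vecMulVec_apply, Pi.star_apply]
  simp only [mul_assoc]

/-- Expanding the three factors 1 + (flip) gives eight terms, one for each subset of parties that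
flip; each is an overlap of the vector with its copy shifted in those indices. This is how the
expectation values in `qubitExp` arise. -/
theorem trace_flip_kronecker (s t r a b c : ℂ) (ψ : Fin 2 × Fin 2 × Fin 2 → ℂ) :
    ((((1 / 2 : ℂ) • (1 + s • flipObs a)) ⊗ₖ (((1 / 2 : ℂ) • (1 + t • flipObs b)) ⊗ₖ
      ((1 / 2 : ℂ) • (1 + r • flipObs c)))) * Matrix.vecMulVec ψ (star ψ)).trace =
    ((∑ i, ∑ j, ∑ k, ψ (i, j, k) * star (ψ (i, j, k)))
    + s * (∑ i, ∑ j, ∑ k, flipPhase a i * ψ (i, j, k) * star (ψ (i + 1, j, k)))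
    + t * (∑ i, ∑ j, ∑ k, flipPhase b j * ψ (i, j, k) * star (ψ (i, j + 1, k)))
    + r * (∑ i, ∑ j, ∑ k, flipPhase c k * ψ (i, j, k) * star (ψ (i, j, k + 1)))
    + s * t * (∑ i, ∑ j, ∑ k, flipPhase a i * flipPhase b j *
        ψ (i, j, k) * star (ψ (i + 1, j + 1, k)))
    + s * r * (∑ i, ∑ j, ∑ k, flipPhase a i * flipPhase c k *
        ψ (i, j, k) * star (ψ (i + 1, j, k + 1)))
    + t * r * (∑ i, ∑ j, ∑ k, flipPhase b j * flipPhase c k *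
        ψ (i, j, k) * star (ψ (i, j + 1, k + 1)))
    + s * t * r * (∑ i, ∑ j, ∑ k, flipPhase a i * flipPhase b j * flipPhase c k *
        ψ (i, j, k) * star (ψ (i + 1, j + 1, k + 1)))) / 8 := by
  rw [trace_kronecker_mul_vecMulVec]
  simp only [Fin.sum_univ_two, flipObs, flipPhase, Matrix.smul_apply, Matrix.add_apply,
    Matrix.one_apply, Fin.isValue, smul_eq_mul, Matrix.cons_val_zero, Matrix.cons_val_one,
    Matrix.of_apply, Matrix.cons_val', Matrix.cons_val_fin_one, zero_add, if_true,
    show ((0 : Fin 2) = 1) = False by simp, show ((1 : Fin 2) = 0) = False by simp, if_false,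
    show (1 + 1 : Fin 2) = 0 from rfl]
  ring

theorem qubitBehaviour_eq_toBehaviour (a b c : Fin 2 → ℂ) (ψ : Fin 2 × Fin 2 × Fin 2 → ℂ)
    (hψ : ∑ i, ∑ j, ∑ k, ψ (i, j, k) * star (ψ (i, j, k)) = 1) :
    qubitBehaviour a b c ψ = (qubitExp a b c ψ).toBehaviour := by
  funext o p q x y z
  simp only [qubitBehaviour, bornBehaviour, flipEffect, trace_flip_kronecker, hψ,
    Expectations.toBehaviour, qubitExp]
  simp only [← Complex.ofReal_mul, Complex.add_re, Complex.re_ofReal_mul, Complex.one_re,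
    Complex.div_ofNat_re]

theorem corr_toBehaviour (K : Expectations) (x y z : Fin 2) :
    corr K.toBehaviour x y z = K.ABC x y z :=
  ((hasExpectations_iff _ K).2 rfl x y z).2.2.2.2.2.2.2

theorem bellB8_toBehaviour (K : Expectations) :
    bellB8 K.toBehaviour = K.ABC 0 0 0 + K.ABC 0 1 1 + K.ABC 1 0 0 - K.ABC 1 1 1 := by
  simp only [bellB8, corr_toBehaviour]

/-! ### The Bell operator on a two-dimensional block -/

/-- The two squares express the optimality conditions y = (1+u)x/√2 and ζ̄y = (1-u)x/√2. Their
x-terms add up to 2|x|² because |1+u|² + |1-u|² = 4, and the cross terms reproduce the Bell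
coefficient. -/
theorem block_sum_of_squares {u ζ : ℂ} (hu : Complex.normSq u = 1) (hζ : Complex.normSq ζ = 1)
    (x y : ℂ) :
    2 * √2 * (Complex.normSq x + Complex.normSq y) -
      2 * (((1 + ζ) + u * (1 - ζ)) * x * star y).re =
    √2 * (Complex.normSq (y - (1 + u) / (√2 : ℝ) * x) +
      Complex.normSq (star ζ * y - (1 - u) / (√2 : ℝ) * x)) := by
  obtain ⟨p, q⟩ := u
  obtain ⟨s, t⟩ := ζ
  obtain ⟨x1, x2⟩ := x
  obtain ⟨y1, y2⟩ := y
  have h2 : √2 * √2 = (2 : ℝ) := Real.mul_self_sqrt (by norm_num)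
  -- With r = 1/√2 and 2r² = 1 the claim becomes a polynomial identity in real coordinates.
  obtain ⟨r, hr⟩ : ∃ r : ℝ, r = (√2)⁻¹ := ⟨_, rfl⟩
  have hr1 : √2 * r = 1 := by rw [hr]; exact mul_inv_cancel₀ (by positivity)
  have hr2 : √2 = 2 * r := by linear_combination r * h2 - √2 * hr1
  have hr3 : 2 * r * r = 1 := by rw [← hr2]; exact hr1
  rw [div_eq_mul_inv, div_eq_mul_inv, ← Complex.ofReal_inv, ← hr, hr2]
  simp only [Complex.normSq_apply] at hu hζ
  simp [Complex.normSq_apply]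
  linear_combination (-2 * r * (y1 * y1 + y2 * y2)) * hζ -
    (4 * r * r * r * (x1 * x1 + x2 * x2)) * hu +
    (-4 * r * (x1 * x1 + x2 * x2) + 2 * (y1 * ((1 + p) * x1 - q * x2) +
      y2 * ((1 + p) * x2 + q * x1)) +
      2 * ((s * y1 + t * y2) * ((1 - p) * x1 + q * x2) +
      (s * y2 - t * y1) * ((1 - p) * x2 - q * x1))) * hr3

/-- Eliminating y gives ζ̄(1+u) = 1-u. Taking moduli, |1+u| = |1-u|, so u is purely imaginary, that
is u = ±i; then ζ̄ = (1-u)/(1+u) = ū. -/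
theorem phase_eq_of_block {u ζ x y : ℂ} (hu : Complex.normSq u = 1) (hζ : Complex.normSq ζ = 1)
    (hx : x ≠ 0) (h1 : y - (1 + u) / (√2 : ℝ) * x = 0)
    (h2 : star ζ * y - (1 - u) / (√2 : ℝ) * x = 0) :
    (∃ ε : ℝ, ε * ε = 1 ∧ u = ε * Complex.I) ∧ ζ = u := by
  have hs : ((√2 : ℝ) : ℂ) ≠ 0 := by
    rw [Complex.ofReal_ne_zero]; positivity
  have h3 : star ζ * (1 + u) = 1 - u := by
    have : (star ζ * (1 + u) - (1 - u)) * (x / (√2 : ℝ)) = 0 := by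
      linear_combination h2 - star ζ * h1
    rcases mul_eq_zero.1 this with h | h
    · exact sub_eq_zero.1 h
    · exact absurd h (div_ne_zero hx hs)
  have h4 : Complex.normSq (1 + u) = Complex.normSq (1 - u) := by
    rw [← h3, map_mul, Complex.star_def, Complex.normSq_conj, hζ, one_mul]
  obtain ⟨p, q⟩ := u
  obtain ⟨s, t⟩ := ζ
  simp [Complex.normSq_apply] at h4 hu
  have hp : p = 0 := by linarith
  subst hp
  simp [Complex.ext_iff] at h3
  refine ⟨⟨q, by linarith, by simp [Complex.ext_iff]⟩, ?_⟩
  obtain ⟨h5, h6⟩ := h3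
  have hs0 : s = 0 := by linear_combination (h5 + q * h6 - (1 + s) * hu) / 2
  subst hs0
  simp only [Complex.ext_iff]
  exact ⟨trivial, by linear_combination q * h5 - t * hu⟩

theorem normSq_flipPhase {a : ℂ} (ha : Complex.normSq a = 1) (i : Fin 2) :
    Complex.normSq (flipPhase a i) = 1 := by
  fin_cases i <;> simp [flipPhase, ha]

/-- The sum of squares that bounds `bellB8` on qubit strategies. -/
theorem bellB8_qubitExp {u v w : ℂ} (hu : Complex.normSq u = 1) (hv : Complex.normSq v = 1)
    (hw : Complex.normSq w = 1) {ψ : Fin 2 × Fin 2 × Fin 2 → ℂ}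
    (hψ : ∑ i, ∑ j, ∑ k, Complex.normSq (ψ (i, j, k)) = 1) :
    2 * √2 - bellB8 (qubitExp ![1, u] ![1, v] ![1, w] ψ).toBehaviour =
      ∑ j, ∑ k, √2 * (Complex.normSq (ψ (1, j + 1, k + 1) - (1 + u) / (√2 : ℝ) * ψ (0, j, k)) +
        Complex.normSq (star (flipPhase v j * flipPhase w k) * ψ (1, j + 1, k + 1) -
          (1 - u) / (√2 : ℝ) * ψ (0, j, k))) := by
  have hz : ∀ j k, Complex.normSq (flipPhase v j * flipPhase w k) = 1 := fun j k => by
    rw [map_mul, normSq_flipPhase hv, normSq_flipPhase hw, one_mul]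
  simp only [← block_sum_of_squares hu (hz _ _)]
  rw [bellB8_toBehaviour]
  simp only [Fin.sum_univ_two, show (1 + 1 : Fin 2) = 0 from rfl, zero_add] at hψ ⊢
  simp [Fin.sum_univ_two, qubitExp, flipPhase]
  linear_combination (-2 * √2) * hψ

/-! ### Optimal vectors supported on one or two blocks -/

theorem toBehaviour_mixture (c : ℝ) (C : Fin 2 → ℝ) (AB : Fin 2 → Fin 2 → ℝ)
    (ABC : Fin 2 → Fin 2 → Fin 2 → ℝ) (K : Expectations)
    (hA : ∀ x, K.A x = 0) (hB : ∀ y, K.B y = 0) (hC : ∀ z, K.C z = c * C z)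
    (hAB : ∀ x y, K.AB x y = c * AB x y) (hAC : ∀ x z, K.AC x z = 0)
    (hBC : ∀ y z, K.BC y z = 0) (hABC : ∀ x y z, K.ABC x y z = ABC x y z) :
    K.toBehaviour =
      ((1 + c) / 2) • Expectations.toBehaviour ⟨fun _ => 0, fun _ => 0, C, AB, fun _ _ => 0,
        fun _ _ => 0, ABC⟩ +
      ((1 - c) / 2) • Expectations.toBehaviour ⟨fun _ => 0, fun _ => 0, fun z => - C z,
        fun x y => - AB x y, fun _ _ => 0, fun _ _ => 0, ABC⟩ := by
  funext o p q x y z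
  simp only [Expectations.toBehaviour, hA, hB, hC, hAB, hAC, hBC, hABC, Pi.add_apply,
    Pi.smul_apply, smul_eq_mul]
  ring

theorem mem_segment_of_mixture {c : ℝ} {p q r : Behaviour}
    (hc : |c| ≤ 1) (h : r = ((1 + c) / 2) • p + ((1 - c) / 2) • q) : r ∈ segment ℝ p q :=
  ⟨(1 + c) / 2, (1 - c) / 2, by linarith [neg_le_of_abs_le hc], by linarith [le_of_abs_le hc],
    by ring, h.symm⟩

theorem sqrt_two_inv_spec : 2 * (√2 : ℝ)⁻¹ * (√2)⁻¹ = 1 := by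
  rw [mul_assoc, ← mul_inv, Real.mul_self_sqrt (by norm_num)]
  norm_num

theorem normSq_to_mul_star {ψ : Fin 2 × Fin 2 × Fin 2 → ℂ}
    (hψ : ∑ i, ∑ j, ∑ k, Complex.normSq (ψ (i, j, k)) = 1) :
    ∑ i, ∑ j, ∑ k, ψ (i, j, k) * star (ψ (i, j, k)) = 1 := by
  simp only [Complex.star_def, Complex.mul_conj]
  exact_mod_cast hψ

theorem normSq_qubit_phase {ε : ℝ} (hε : ε * ε = 1) :
    Complex.normSq ((1 + ε * Complex.I) / (√2 : ℝ)) = 1 := by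
  have := sqrt_two_inv_spec
  rw [div_eq_mul_inv, map_mul, ← Complex.ofReal_inv, Complex.normSq_ofReal]
  simp [Complex.normSq_apply, hε]
  linarith

/-- The vector with `ψ (0, j, k) = x k`, `ψ (1, j + 1, k + 1) = κ * x k`, and no other entries. -/
def doubleBlock (κ : ℂ) (j : Fin 2) (x : Fin 2 → ℂ) : Fin 2 × Fin 2 × Fin 2 → ℂ := fun p =>
  if p.1 = 0 then (if p.2.1 = j then x p.2.2 else 0)
  else (if p.2.1 = j then 0 else κ * x (p.2.2 + 1))

/-- The overlap c of the two blocks enters only ⟨C⟩ and ⟨AB⟩, linearly, while ⟨ABC⟩ does not depend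
on it. This is the shape that `toBehaviour_mixture` splits into the two extremes c = ±1. The
parameter r stands for 1/√2. -/
theorem doubleBlock_qubitExp (ε η r : ℝ) (hε : ε = 1 ∨ ε = -1) (hη : η = 1 ∨ η = -1)
    (hr : 2 * r * r = 1) (j : Fin 2) (x : Fin 2 → ℂ)
    (hx : Complex.normSq (x 0) + Complex.normSq (x 1) = 1 / 2) (v : ℂ)
    (hv : flipPhase v j = η * (ε * Complex.I)) :
    let K := qubitExp ![1, ε * Complex.I] ![1, v] ![1, (η : ℂ)]
      (doubleBlock ((1 + ε * Complex.I) * r) j x)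
    let c := 4 * (x 0 * star (x 1)).re
    (∀ a, K.A a = 0) ∧ (∀ b, K.B b = 0) ∧ (∀ z, K.C z = c * η ^ (z : ℕ)) ∧
    (∀ a b, K.AB a b = c * (if a = 0 then (if b = 0 then r else η * r)
      else (if b = 0 then r else - (η * r)))) ∧
    (∀ a b, K.AC a b = 0) ∧ (∀ a b, K.BC a b = 0) ∧
    (∀ a b z, K.ABC a b z = η ^ (z : ℕ) * (if a = 0 then (if b = 0 then r else η * r)
      else (if b = 0 then r else - (η * r)))) := by
  intro K c
  -- Conjugation negates an imaginary phase, so reading v off at j = 1 instead of j = 0 costs a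
  -- sign.
  have hv' : v = (if j = 0 then 1 else -1) * (η * (ε * Complex.I)) := by
    fin_cases j
    · simpa [flipPhase] using hv
    · simp only [flipPhase, Fin.mk_one, Matrix.cons_val_one, Matrix.cons_val_fin_one] at hv
      rw [← star_star v, hv]
      simp
  clear hv
  obtain ⟨x0, h0⟩ : ∃ y, y = x 0 := ⟨_, rfl⟩
  obtain ⟨x1, h1⟩ : ∃ y, y = x 1 := ⟨_, rfl⟩
  obtain ⟨p0, q0⟩ := x0
  obtain ⟨p1, q1⟩ := x1
  simp only [K, c]
  rw [← h0, ← h1] at hx ⊢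
  simp only [Complex.normSq_mk] at hx
  simp only [qubitExp, doubleBlock, Fin.sum_univ_two, Fin.forall_fin_two,
    show (1 + 1 : Fin 2) = 0 from rfl, zero_add]
  rcases hε with rfl | rfl <;> rcases hη with rfl | rfl <;> fin_cases j <;>
    simp [flipPhase, hv', ← h0, ← h1] <;>
    repeat' apply And.intro
  all_goals first
    | ring1
    | linear_combination (2 * r) * hx
    | linear_combination (-2 * r) * hx
    | linear_combination (2 * (p0 * p1 + q0 * q1)) * hr
    | linear_combination (-2 * (p0 * p1 + q0 * q1)) * hr

/-- A strategy supported on two blocks that share Bob's index is a mixture of strategies in which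
Charlie's outcome is deterministic. -/
theorem doubleBlock_eq_mixture {ε η : ℝ} (hε : ε = 1 ∨ ε = -1) (hη : η = 1 ∨ η = -1)
    (j : Fin 2) {x : Fin 2 → ℂ} (hx : Complex.normSq (x 0) + Complex.normSq (x 1) = 1 / 2)
    {v : ℂ} (hv : flipPhase v j = η * (ε * Complex.I)) :
    (qubitExp ![1, ε * Complex.I] ![1, v] ![1, (η : ℂ)]
      (doubleBlock ((1 + ε * Complex.I) / (√2 : ℝ)) j x)).toBehaviour =
      ((1 + 4 * (x 0 * star (x 1)).re) / 2) • (if η = 1 then point1 else point3) +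
      ((1 - 4 * (x 0 * star (x 1)).re) / 2) • (if η = 1 then point2 else point4) := by
  obtain ⟨hA, hB, hC, hAB, hAC, hBC, hABC⟩ :=
    doubleBlock_qubitExp ε η (√2)⁻¹ hε hη sqrt_two_inv_spec j x hx v hv
  rw [Complex.ofReal_inv, ← div_eq_mul_inv] at hA hB hC hAB hAC hBC hABC
  rw [toBehaviour_mixture _ _ _ _ _ hA hB hC hAB hAC hBC hABC]
  rcases hη with rfl | rfl
  · rw [if_pos rfl, if_pos rfl]
    congr 2 <;> refine congrArg Expectations.toBehaviour ?_ <;>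
      simp [funext_iff, Fin.forall_fin_two, div_eq_mul_inv]
  · rw [if_neg (by norm_num), if_neg (by norm_num)]
    congr 2 <;> refine congrArg Expectations.toBehaviour ?_ <;>
      simp [funext_iff, Fin.forall_fin_two, div_eq_mul_inv] <;> norm_num

theorem doubleBlock_mem_segment {ε η : ℝ} (hε : ε = 1 ∨ ε = -1) (hη : η = 1 ∨ η = -1)
    (j : Fin 2) {x : Fin 2 → ℂ} (hx : Complex.normSq (x 0) + Complex.normSq (x 1) = 1 / 2)
    {v : ℂ} (hv : flipPhase v j = η * (ε * Complex.I)) :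
    (qubitExp ![1, ε * Complex.I] ![1, v] ![1, (η : ℂ)]
      (doubleBlock ((1 + ε * Complex.I) / (√2 : ℝ)) j x)).toBehaviour ∈
      (if η = 1 then segment ℝ point1 point2 else segment ℝ point3 point4) := by
  -- Expand |x₀ ± x₁|² ≥ 0 with |x₀|² + |x₁|² = 1/2.
  have hc : |4 * (x 0 * star (x 1)).re| ≤ 1 := by
    have h1 := Complex.normSq_nonneg (x 0 + x 1)
    have h2 := Complex.normSq_nonneg (x 0 - x 1)
    rw [Complex.normSq_add, hx] at h1
    rw [Complex.normSq_sub, hx] at h2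
    rw [abs_le]
    simp only [Complex.star_def]
    constructor <;> linarith
  have h := mem_segment_of_mixture hc (doubleBlock_eq_mixture hε hη j hx hv)
  split_ifs at h ⊢ <;> exact h

theorem eq_of_flipPhase_eq {a b : ℂ} {i : Fin 2} (h : flipPhase a i = b) :
    a = if i = 0 then b else star b := by
  fin_cases i
  · simpa [flipPhase] using h
  · simp only [flipPhase, Fin.mk_one, Matrix.cons_val_one, Matrix.cons_val_fin_one] at h
    simp [← h]

/-- On the two basis vectors of one block, flipping only one or two parties leaves the support, so
only three-body values survive. They are real parts of products of phases, with s + it the phase of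
Charlie's second observable at k. -/
theorem singleBlock_qubitExp (ε r s t : ℝ) (hε : ε = 1 ∨ ε = -1) (hst : s * s + t * t = 1)
    (j k : Fin 2) (x : Fin 2 → ℂ) (hx : Complex.normSq (x k) = 1 / 2) (hx' : x (k + 1) = 0)
    (v w : ℂ) (hw : flipPhase w k = ⟨s, t⟩)
    (hv : flipPhase v j * flipPhase w k = ε * Complex.I) :
    qubitExp ![1, ε * Complex.I] ![1, v] ![1, w] (doubleBlock ((1 + ε * Complex.I) * r) j x) =
      { A := fun _ => 0
        B := fun _ => 0
        C := fun _ => 0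
        AB := fun _ _ => 0
        AC := fun _ _ => 0
        BC := fun _ _ => 0
        ABC := ![![![r, (s + ε * t) * r], ![(s + ε * t) * r, r]],
             ![![r, (s - ε * t) * r], ![-((s - ε * t) * r), -r]]] } := by
  have hv1 : flipPhase v j = ε * Complex.I * star (⟨s, t⟩ : ℂ) := by
    rw [← hv, hw, mul_assoc, Complex.star_def, Complex.mul_conj, Complex.normSq_mk, hst]
    simp
  have hv' := eq_of_flipPhase_eq hv1
  have hw' := eq_of_flipPhase_eq hw
  clear hv hv1 hw
  obtain ⟨x0, h0⟩ : ∃ y, y = x k := ⟨_, rfl⟩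
  obtain ⟨p, q⟩ := x0
  rw [← h0] at hx
  simp only [Complex.normSq_mk] at hx
  simp only [qubitExp, Fin.sum_univ_two, show (1 + 1 : Fin 2) = 0 from rfl, zero_add,
    Expectations.mk.injEq, funext_iff, Fin.forall_fin_two, doubleBlock]
  rcases hε with rfl | rfl <;> fin_cases j <;> fin_cases k <;>
    (simp at h0 hx' hv' hw'
     simp [flipPhase, hv', ← h0, hw', hx']
     repeat' apply And.intro)
  all_goals first
    | linear_combination (2 * r) * hx
    | linear_combination (-2 * r) * hx
    | linear_combination (2 * (s + t) * r) * hx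
    | linear_combination (-2 * (s + t) * r) * hx
    | linear_combination (2 * (s - t) * r) * hx
    | linear_combination (-2 * (s - t) * r) * hx
    | linear_combination (2 * r * (s * s + t * t)) * hx + r * hst
    | linear_combination (-2 * r * (s * s + t * t)) * hx - r * hst

theorem exists_angle {a b : ℝ} (h : a * a + b * b = 1) :
    ∃ α ∈ Set.Icc 0 (2 * Real.pi), Real.cos α = a ∧ Real.sin α = b := by
  have hn : ‖(⟨a, b⟩ : ℂ)‖ = 1 := by
    rw [← sq_eq_sq₀ (norm_nonneg _) zero_le_one, ← Complex.normSq_eq_norm_sq, Complex.normSq_mk, h]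
    norm_num
  have h0 : (⟨a, b⟩ : ℂ) ≠ 0 := fun h => by simp [h] at hn
  have hc := Complex.cos_arg h0
  have hs := Complex.sin_arg (⟨a, b⟩ : ℂ)
  rw [hn, div_one] at hc hs
  have h1 := Complex.neg_pi_lt_arg (⟨a, b⟩ : ℂ)
  have h2 := Complex.arg_le_pi (⟨a, b⟩ : ℂ)
  by_cases hle : 0 ≤ Complex.arg ⟨a, b⟩
  · exact ⟨_, ⟨hle, by linarith [Real.pi_pos]⟩, hc, hs⟩
  · refine ⟨Complex.arg ⟨a, b⟩ + 2 * Real.pi, ⟨by linarith, by linarith⟩, ?_, ?_⟩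
    · rw [Real.cos_add_two_pi, hc]
    · rw [Real.sin_add_two_pi, hs]

theorem singleBlock_mem_family {ε : ℝ} (hε : ε = 1 ∨ ε = -1) (j k : Fin 2) {x : Fin 2 → ℂ}
    (hx : Complex.normSq (x k) = 1 / 2) (hx' : x (k + 1) = 0) {v w : ℂ}
    (hw1 : Complex.normSq w = 1) (hv : flipPhase v j * flipPhase w k = ε * Complex.I) :
    (qubitExp ![1, ε * Complex.I] ![1, v] ![1, w]
      (doubleBlock ((1 + ε * Complex.I) / (√2 : ℝ)) j x)).toBehaviour ∈
      familyPoint '' Set.Icc 0 (2 * Real.pi) := by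
  obtain ⟨s, t, hst⟩ : ∃ s t, flipPhase w k = ⟨s, t⟩ := ⟨_, _, rfl⟩
  have hst1 := normSq_flipPhase hw1 k
  rw [hst, Complex.normSq_mk] at hst1
  have hε2 : ε * ε = 1 := by rcases hε with rfl | rfl <;> norm_num
  -- These are the two free three-body values; their squares add up to s² + t² = 1, since ε² = 1.
  obtain ⟨α, hα, hc, hs⟩ := exists_angle
    (a := (s + ε * t) * (√2)⁻¹) (b := (s - ε * t) * (√2)⁻¹) (by
      linear_combination (2 * (√2)⁻¹ * (√2)⁻¹ * t * t) * hε2 + (2 * (√2)⁻¹ * (√2)⁻¹) * hst1 +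
        sqrt_two_inv_spec)
  refine ⟨α, hα, ?_⟩
  rw [div_eq_mul_inv, ← Complex.ofReal_inv,
    singleBlock_qubitExp ε _ s t hε hst1 j k x hx hx' v w hst hv, familyPoint, hc, hs, one_div]

/-- If the second block is empty the point is some R_α. Otherwise both blocks have the same product
of phases, so Charlie's phase equals its conjugate and is ±1. -/
theorem doubleBlock_mem {ε : ℝ} (hε : ε = 1 ∨ ε = -1) (j k : Fin 2) {x : Fin 2 → ℂ}
    (hx : Complex.normSq (x 0) + Complex.normSq (x 1) = 1 / 2) {v w : ℂ}
    (hw1 : Complex.normSq w = 1) (hv : flipPhase v j * flipPhase w k = ε * Complex.I)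
    (hv' : x (k + 1) = 0 ∨ flipPhase v j * flipPhase w (k + 1) = ε * Complex.I) :
    (qubitExp ![1, ε * Complex.I] ![1, v] ![1, w]
      (doubleBlock ((1 + ε * Complex.I) / (√2 : ℝ)) j x)).toBehaviour ∈
      segment ℝ point1 point2 ∪ segment ℝ point3 point4 ∪
      familyPoint '' Set.Icc 0 (2 * Real.pi) := by
  rcases hv' with h0 | hv'
  · refine Or.inr (singleBlock_mem_family hε j k ?_ h0 hw1 hv)
    fin_cases k <;> simp at h0 ⊢ <;> simpa [h0] using hx
  · left
    have hε0 : (ε : ℂ) * Complex.I ≠ 0 := by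
      refine mul_ne_zero ?_ Complex.I_ne_zero
      rcases hε with rfl | rfl <;> simp
    have hv0 : flipPhase v j ≠ 0 := fun h => hε0 (by rw [← hv, h, zero_mul])
    have hww : flipPhase w k = flipPhase w (k + 1) := mul_left_cancel₀ hv0 (hv.trans hv'.symm)
    have hreal : w = star w := by
      fin_cases k <;> simp [flipPhase] at hww ⊢ <;> first | exact hww | exact hww.symm
    obtain ⟨η, hη, hwη⟩ : ∃ η : ℝ, (η = 1 ∨ η = -1) ∧ w = η := by
      obtain ⟨p, q⟩ := w
      simp [Complex.ext_iff] at hreal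
      have hq : q = 0 := by linarith
      subst hq
      refine ⟨p, mul_self_eq_one_iff.1 (by simpa using hw1), ?_⟩
      simp [Complex.ext_iff]
    subst hwη
    have hη2 : η * η = 1 := by rcases hη with rfl | rfl <;> norm_num
    have hk : flipPhase (η : ℂ) k = η := by fin_cases k <;> simp [flipPhase]
    have hvj : flipPhase v j = η * (ε * Complex.I) := by
      have : ((η * η : ℝ) : ℂ) = 1 := by rw [hη2]; simp
      push_cast at this
      rw [← hv, hk]
      linear_combination (-flipPhase v j) * this
    have h := doubleBlock_mem_segment hε hη j hx hvj
    split_ifs at h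
    · exact Or.inl h
    · exact Or.inr h

/-! ### Exchange of Bob and Charlie, and the optimal qubit strategies -/

theorem swapBC_qubitExp (a b c : Fin 2 → ℂ) (ψ : Fin 2 × Fin 2 × Fin 2 → ℂ) :
    swapBC (qubitExp a b c ψ).toBehaviour =
      (qubitExp a c b fun p => ψ (p.1, p.2.2, p.2.1)).toBehaviour := by
  funext o p q x y z
  simp only [swapBC, Expectations.toBehaviour, qubitExp, Fin.sum_univ_two]
  simp only [mul_right_comm _ (flipPhase (b z) _) (flipPhase (c y) _),
    mul_comm (flipPhase (b z) _) (flipPhase (c y) _)]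
  simp only [Complex.add_re]
  ring

/-- The exchange swaps ⟨A₁B₀C₁⟩ = sin α with ⟨A₁B₁C₀⟩ = -sin α and keeps the cosines. The angle 2π -
α, rather than -α, stays in [0, 2π]. -/
theorem swapBC_familyPoint (α : ℝ) : swapBC (familyPoint α) = familyPoint (2 * Real.pi - α) := by
  funext o p q x y z
  simp only [swapBC, Expectations.toBehaviour, familyPoint]
  fin_cases x <;> fin_cases y <;> fin_cases z <;> simp <;> ring_nf <;> simp

theorem swapBC_mem_segment {P Q R : Behaviour} (h : R ∈ segment ℝ P Q) :
    swapBC R ∈ segment ℝ (swapBC P) (swapBC Q) := by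
  obtain ⟨a, b, ha, hb, hab, rfl⟩ := h
  exact ⟨a, b, ha, hb, hab, rfl⟩

/-- The candidate for the quantum face. -/
def faceHull : Set Behaviour :=
  convexHull ℝ (Set.range points ∪ familyPoint '' Set.Icc 0 (2 * Real.pi))

theorem points_mem_faceHull (i : Fin 8) : points i ∈ faceHull :=
  subset_convexHull _ _ (Or.inl ⟨i, rfl⟩)

theorem mem_faceHull {R : Behaviour} (h : R ∈ segment ℝ point1 point2 ∪ segment ℝ point3 point4 ∪
      familyPoint '' Set.Icc 0 (2 * Real.pi)) : R ∈ faceHull ∧ swapBC R ∈ faceHull := by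
  have hconv : Convex ℝ faceHull := convex_convexHull ℝ _
  rcases h with (h | h) | ⟨α, hα, rfl⟩
  · exact ⟨hconv.segment_subset (points_mem_faceHull 0) (points_mem_faceHull 1) h,
      hconv.segment_subset (points_mem_faceHull 4) (points_mem_faceHull 5) (swapBC_mem_segment h)⟩
  · exact ⟨hconv.segment_subset (points_mem_faceHull 2) (points_mem_faceHull 3) h,
      hconv.segment_subset (points_mem_faceHull 6) (points_mem_faceHull 7) (swapBC_mem_segment h)⟩
  · refine ⟨subset_convexHull _ _ (Or.inr ⟨α, hα, rfl⟩), ?_⟩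
    rw [swapBC_familyPoint]
    exact subset_convexHull _ _ (Or.inr ⟨_, ⟨by linarith [hα.2], by linarith [hα.1]⟩, rfl⟩)

theorem flipPhase_succ (a : ℂ) (i : Fin 2) : flipPhase a (i + 1) = star (flipPhase a i) := by
  fin_cases i <;> simp [flipPhase]

theorem fin_two_eq_or (i j : Fin 2) : i = j ∨ i = j + 1 := by
  revert i j
  decide

/-- Optimal qubit strategies lie in the hull of the extremal points. -/
theorem qubitExp_mem_faceHull {u v w : ℂ} (hu : Complex.normSq u = 1) (hv : Complex.normSq v = 1)
    (hw : Complex.normSq w = 1) {ψ : Fin 2 × Fin 2 × Fin 2 → ℂ}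
    (hψ : ∑ i, ∑ j, ∑ k, Complex.normSq (ψ (i, j, k)) = 1)
    (hB : bellB8 (qubitExp ![1, u] ![1, v] ![1, w] ψ).toBehaviour = 2 * √2) :
    (qubitExp ![1, u] ![1, v] ![1, w] ψ).toBehaviour ∈ faceHull := by
  have hz : ∀ j k, Complex.normSq (flipPhase v j * flipPhase w k) = 1 := fun j k => by
    rw [map_mul, normSq_flipPhase hv, normSq_flipPhase hw, one_mul]
  -- At the maximum a sum of nonnegative terms vanishes, so both squares vanish in every block.
  have hblocks : ∀ j k, ψ (1, j + 1, k + 1) - (1 + u) / (√2 : ℝ) * ψ (0, j, k) = 0 ∧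
      star (flipPhase v j * flipPhase w k) * ψ (1, j + 1, k + 1) -
          (1 - u) / (√2 : ℝ) * ψ (0, j, k) = 0 := by
    intro j k
    have h := bellB8_qubitExp hu hv hw hψ
    rw [hB, sub_self] at h
    have hnn : ∀ x y : ℂ, 0 ≤ √2 * (Complex.normSq x + Complex.normSq y) := fun x y =>
      mul_nonneg (Real.sqrt_nonneg _) (add_nonneg (Complex.normSq_nonneg _)
        (Complex.normSq_nonneg _))
    have h1 := (Finset.sum_eq_zero_iff_of_nonneg
      (fun j _ => Finset.sum_nonneg fun k _ => hnn _ _)).1 h.symm j (Finset.mem_univ _)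
    have h2 := (Finset.sum_eq_zero_iff_of_nonneg
      (fun k _ => hnn _ _)).1 h1 k (Finset.mem_univ _)
    have h3 := (mul_eq_zero.1 h2).resolve_left (by positivity)
    have h4 := (add_eq_zero_iff_of_nonneg (Complex.normSq_nonneg _)
      (Complex.normSq_nonneg _)).1 h3
    exact ⟨Complex.normSq_eq_zero.1 h4.1, Complex.normSq_eq_zero.1 h4.2⟩
  have hψ1 : ∀ j k, ψ (1, j + 1, k + 1) = (1 + u) / (√2 : ℝ) * ψ (0, j, k) := fun j k =>
    sub_eq_zero.1 (hblocks j k).1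
  have hphase : ∀ j k, ψ (0, j, k) ≠ 0 →
      (∃ ε : ℝ, ε * ε = 1 ∧ u = ε * Complex.I) ∧ flipPhase v j * flipPhase w k = u :=
    fun j k h => phase_eq_of_block hu (hz j k) h (hblocks j k).1 (hblocks j k).2
  obtain ⟨j, k, hjk⟩ : ∃ j k, ψ (0, j, k) ≠ 0 := by
    by_contra! h
    have h1 : ∀ j k, ψ (1, j + 1, k + 1) = 0 := fun j k => by rw [hψ1, h, mul_zero]
    have h1' := h1 0 0
    have h2' := h1 0 1
    have h3' := h1 1 0
    have h4' := h1 1 1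
    simp only [show (1 + 1 : Fin 2) = 0 from rfl, zero_add] at h1' h2' h3' h4'
    simp [Fin.sum_univ_two, h, h1', h2', h3', h4'] at hψ
  obtain ⟨⟨ε, hε2, rfl⟩, hvw⟩ := hphase j k hjk
  have hε := mul_self_eq_one_iff.1 hε2
  have hκ := normSq_qubit_phase hε2
  have hη2 : (ε : ℂ) * ε = 1 := by exact_mod_cast hε2
  -- Changing both indices conjugates the product of phases, whereas ±i is not real.
  have hdiag : ψ (0, j + 1, k + 1) = 0 := by
    by_contra h
    have h1 := (hphase _ _ h).2
    rw [flipPhase_succ, flipPhase_succ, ← star_mul', hvw] at h1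
    rcases hε with rfl | rfl <;> simp [Complex.ext_iff] at h1 <;> norm_num at h1
  -- If both of these blocks were occupied, their phase products would multiply to |v|²|w|² = 1, but
  -- also to u² = -1.
  have hoff : ψ (0, j + 1, k) = 0 ∨ ψ (0, j, k + 1) = 0 := by
    by_contra! h
    have h1 := (hphase _ _ h.1).2
    have h2 := (hphase _ _ h.2).2
    rw [flipPhase_succ] at h1 h2
    have h3 : (flipPhase v j * star (flipPhase v j)) * (flipPhase w k * star (flipPhase w k)) =
        (ε * Complex.I) * (ε * Complex.I) := by
      nth_rw 1 [← h1]
      rw [← h2]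
      ring
    simp only [Complex.star_def] at h3
    rw [Complex.mul_conj, Complex.mul_conj,
      normSq_flipPhase hv, normSq_flipPhase hw, mul_mul_mul_comm, hη2, Complex.I_mul_I] at h3
    norm_num at h3
  have hnorm : ∑ j, ∑ k, Complex.normSq (ψ (0, j, k)) = 1 / 2 := by
    have h1 : ∀ j k, Complex.normSq (ψ (1, j + 1, k + 1)) = Complex.normSq (ψ (0, j, k)) :=
      fun j k => by rw [hψ1, map_mul, hκ, one_mul]
    have h1' := h1 0 0
    have h2' := h1 0 1
    have h3' := h1 1 0
    have h4' := h1 1 1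
    simp only [show (1 + 1 : Fin 2) = 0 from rfl, zero_add] at h1' h2' h3' h4'
    simp only [Fin.sum_univ_two] at hψ ⊢
    linarith
  have key : ∀ (φ : Fin 2 × Fin 2 × Fin 2 → ℂ) (j : Fin 2),
      (∀ j k, φ (1, j + 1, k + 1) = (1 + ε * Complex.I) / (√2 : ℝ) * φ (0, j, k)) →
      (∀ k, φ (0, j + 1, k) = 0) → ∑ j, ∑ k, Complex.normSq (φ (0, j, k)) = 1 / 2 →
      φ = doubleBlock ((1 + ε * Complex.I) / (√2 : ℝ)) j (fun k => φ (0, j, k)) ∧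
      Complex.normSq (φ (0, j, 0)) + Complex.normSq (φ (0, j, 1)) = 1 / 2 := by
    intro φ j h1 h0 hn
    constructor
    · funext ⟨i, j', k'⟩
      have e1 := h1 (j' + 1) (k' + 1)
      have two : ∀ i : Fin 2, i + 1 + 1 = i := by decide
      rw [two, two] at e1
      have hj : j' = j ∨ j' = j + 1 := fin_two_eq_or j' j
      have hne : j + 1 ≠ j := by simp
      fin_cases i
      · rcases hj with rfl | rfl <;> simp [doubleBlock, h0]
      · rcases hj with rfl | rfl
        · simp [doubleBlock, e1, h0]
        · rw [two] at e1
          simp [doubleBlock, e1]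
    · have a0 := h0 0
      have a1 := h0 1
      fin_cases j <;> simp [Fin.sum_univ_two] at a0 a1 hn ⊢ <;> simpa [a0, a1] using hn
  rcases hoff with h0 | h0
  · have h0' : ∀ k', ψ (0, j + 1, k') = 0 := by
      intro k'
      rcases fin_two_eq_or k' k with rfl | rfl
      exacts [h0, hdiag]
    obtain ⟨e, hn⟩ := key ψ j hψ1 h0' hnorm
    rw [e]
    refine (mem_faceHull (doubleBlock_mem hε j k hn hw hvw ?_)).1
    by_cases h : ψ (0, j, k + 1) = 0
    exacts [Or.inl h, Or.inr (hphase _ _ h).2]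
  · have h0' : ∀ j', ψ (0, j', k + 1) = 0 := by
      intro j'
      rcases fin_two_eq_or j' j with rfl | rfl
      exacts [h0, hdiag]
    obtain ⟨e, hn⟩ := key (fun p => ψ (p.1, p.2.2, p.2.1)) k (fun a b => hψ1 b a) h0' (by
      rw [Finset.sum_comm]; exact hnorm)
    -- The surviving blocks share Charlie's index; after the exchange they share Bob's, and the
    -- result is exchanged back.
    have hs := swapBC_qubitExp ![1, ε * Complex.I] ![1, w] ![1, v] fun p => ψ (p.1, p.2.2, p.2.1)
    rw [← hs, e]
    refine (mem_faceHull (doubleBlock_mem hε k j hn hv ((mul_comm _ _).trans hvw) ?_)).2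
    by_cases h : ψ (0, j + 1, k) = 0
    exacts [Or.inl h, Or.inr ((mul_comm _ _).trans (hphase _ _ h).2)]

/-! ### Jordan's lemma and dilation of two-outcome measurements -/

/-- Commuting symmetric operators have a joint orthonormal eigenbasis. -/
theorem exists_joint_eigenbasis {V : Type*} [NormedAddCommGroup V] [InnerProductSpace ℂ V]
    [FiniteDimensional ℂ V] {n : ℕ} (hn : Module.finrank ℂ V = n) {A B : V →ₗ[ℂ] V}
    (hA : A.IsSymmetric) (hB : B.IsSymmetric) (hAB : Commute A B) :
    ∃ b : OrthonormalBasis (Fin n) ℂ V, ∀ i, ∃ α β : ℂ, A (b i) = α • b i ∧ B (b i) = β • b i := by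
  classical
  have hint := LinearMap.IsSymmetric.directSum_isInternal_of_commute hA hB hAB
  have horth := LinearMap.IsSymmetric.orthogonalFamily_eigenspace_inf_eigenspace hA hB
  let b := hint.collectedBasis fun i => (stdOrthonormalBasis ℂ
    (Module.End.eigenspace A i.2 ⊓ Module.End.eigenspace B i.1 : Submodule ℂ V)).toBasis
  have hb : Orthonormal ℂ b := hint.collectedBasis_orthonormal horth fun i => by simp
  let _ := FiniteDimensional.fintypeBasisIndex b
  refine ⟨(b.toOrthonormalBasis hb).reindex
    (Fintype.equivFinOfCardEq ((Module.finrank_eq_card_basis b).symm.trans hn)), fun i => ?_⟩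
  rw [OrthonormalBasis.reindex_apply, Module.Basis.coe_toOrthonormalBasis]
  have h := Submodule.mem_inf.1 (hint.collectedBasis_mem (fun i => (stdOrthonormalBasis ℂ
    (Module.End.eigenspace A i.2 ⊓ Module.End.eigenspace B i.1 : Submodule ℂ V)).toBasis)
    ((Fintype.equivFinOfCardEq ((Module.finrank_eq_card_basis b).symm.trans hn)).symm i))
  exact ⟨_, _, Module.End.mem_eigenspace_iff.1 h.1, Module.End.mem_eigenspace_iff.1 h.2⟩

-- A unitary commutes with its adjoint, so the Hermitian matrices U + Uᴴ and i(U - Uᴴ) commute; a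
-- joint eigenbasis for them diagonalises U.
open Matrix in
theorem exists_orthonormal_eigenbasis {m : Type*} [Fintype m] [DecidableEq m]
    {U : Matrix m m ℂ} (hU : Uᴴ * U = 1) :
    ∃ b : OrthonormalBasis m ℂ (EuclideanSpace ℂ m), ∀ i, ∃ z : ℂ,
      U *ᵥ (b i).ofLp = z • (b i).ofLp := by
  classical
  have hU' : U * Uᴴ = 1 := mul_eq_one_comm.1 hU
  obtain ⟨H₁, hH₁⟩ : ∃ H : Matrix m m ℂ, H = U + Uᴴ := ⟨_, rfl⟩
  obtain ⟨H₂, hH₂⟩ : ∃ H : Matrix m m ℂ, H = Complex.I • (U - Uᴴ) := ⟨_, rfl⟩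
  have h₁ : H₁.IsHermitian := by
    simp [hH₁, IsHermitian, add_comm]
  have h₂ : H₂.IsHermitian := by
    simp only [hH₂, IsHermitian, conjTranspose_smul, conjTranspose_sub,
      conjTranspose_conjTranspose, Complex.star_def, Complex.conj_I, neg_smul, ← smul_neg, neg_sub]
  have hs₁ := isSymmetric_toEuclideanLin_iff.2 h₁
  have hs₂ := isSymmetric_toEuclideanLin_iff.2 h₂
  have hcomm : H₁ * H₂ = H₂ * H₁ := by
    simp only [hH₁, hH₂, Matrix.mul_smul, Matrix.smul_mul, add_mul, mul_sub, sub_mul, mul_add,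
      hU, hU']
  have hcomm' : Commute (toEuclideanLin H₁) (toEuclideanLin H₂) := by
    refine LinearMap.ext fun x => ?_
    simp only [Module.End.mul_apply, toLpLin_apply, mulVec_mulVec, hcomm]
  have hUH : U = (1 / 2 : ℂ) • (H₁ - Complex.I • H₂) := by
    rw [hH₁, hH₂, smul_smul, Complex.I_mul_I]
    module
  clear hH₁ hH₂
  obtain ⟨b, hb⟩ := exists_joint_eigenbasis (finrank_euclideanSpace (𝕜 := ℂ) (ι := m)) hs₁ hs₂
    hcomm'
  refine ⟨b.reindex (Fintype.equivOfCardEq (Fintype.card_fin _)), fun i => ?_⟩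
  rw [OrthonormalBasis.reindex_apply]
  obtain ⟨α, β, e₁, e₂⟩ := hb ((Fintype.equivOfCardEq (Fintype.card_fin _)).symm i)
  have e₁' := congrArg WithLp.ofLp e₁
  have e₂' := congrArg WithLp.ofLp e₂
  simp only [toLpLin_apply, WithLp.ofLp_smul] at e₁' e₂'
  refine ⟨(α - Complex.I * β) / 2, ?_⟩
  rw [hUH, smul_mulVec, sub_mulVec, smul_mulVec, e₁', e₂']
  module

open Matrix in
/-- Unitary matrices are unitarily diagonalisable. -/
theorem exists_unitary_diagonalization {m : Type*} [Fintype m] [DecidableEq m]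
    {U : Matrix m m ℂ} (hU : Uᴴ * U = 1) :
    ∃ (O : Matrix m m ℂ) (u : m → ℂ), O * Oᴴ = 1 ∧ Oᴴ * O = 1 ∧
      (∀ i, Complex.normSq (u i) = 1) ∧ U = O * diagonal u * Oᴴ := by
  obtain ⟨b, heig⟩ := exists_orthonormal_eigenbasis hU
  choose u hu using heig
  obtain ⟨O, hO⟩ : ∃ O : Matrix m m ℂ, O = (EuclideanSpace.basisFun m ℂ).toBasis.toMatrix b :=
    ⟨_, rfl⟩
  have hOp : ∀ p i, O p i = (b i).ofLp p := fun p i => by rw [hO]; rfl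
  have hOO : Oᴴ * O = 1 := by
    rw [hO]
    exact (EuclideanSpace.basisFun m ℂ).toMatrix_orthonormalBasis_conjTranspose_mul_self b
  have hOO' : O * Oᴴ = 1 := mul_eq_one_comm.1 hOO
  have hUO : U * O = O * diagonal u := by
    ext p i
    have := congrFun (hu i) p
    simp only [mulVec, dotProduct, Pi.smul_apply, smul_eq_mul] at this
    rw [mul_diagonal, Matrix.mul_apply, hOp, mul_comm, ← this]
    simp only [hOp]
  have hUd : U = O * diagonal u * Oᴴ := by rw [← hUO, mul_assoc, hOO', mul_one]
  refine ⟨O, u, hOO', hOO, fun i => ?_, hUd⟩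
  have hd : diagonal u = Oᴴ * U * O := by
    rw [mul_assoc, hUO, ← mul_assoc, hOO, one_mul]
  have hdd : (diagonal u)ᴴ * diagonal u = 1 := by
    rw [hd, conjTranspose_mul, conjTranspose_mul, conjTranspose_conjTranspose]
    calc Oᴴ * (Uᴴ * O) * (Oᴴ * U * O) = Oᴴ * (Uᴴ * (O * Oᴴ) * U) * O := by
          simp only [mul_assoc]
      _ = 1 := by rw [hOO', mul_one, hU, mul_one, hOO]
  have := congrFun (congrFun hdd i) i
  rw [diagonal_conjTranspose, diagonal_mul_diagonal, diagonal_apply_eq, one_apply_eq,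
    Pi.star_apply, Complex.star_def, mul_comm, Complex.mul_conj] at this
  exact_mod_cast this

open Matrix in
theorem sum_conj_flipObs {m n : Type*} [Fintype m] [DecidableEq m] (X Y : Matrix m n ℂ)
    (u : m → ℂ) :
    ∑ i, (of ![X i, Y i])ᴴ * flipObs (u i) * of ![X i, Y i] =
      Xᴴ * diagonal (star u) * Y + Yᴴ * diagonal u * X := by
  ext p q
  simp only [Matrix.sum_apply, Matrix.mul_apply, Fin.sum_univ_two, flipObs, Matrix.add_apply,
    conjTranspose_apply, of_apply, cons_val_zero, cons_val_one, cons_val', cons_val_fin_one,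
    ← Finset.sum_add_distrib]
  refine Finset.sum_congr rfl fun i _ => ?_
  simp only [mul_zero, add_zero, zero_add, diagonal_apply, Pi.star_apply, mul_ite,
    Finset.sum_ite_eq', Finset.mem_univ, if_true]
  ring

open Matrix in
theorem sum_conj_one {m n : Type*} [Fintype m] [DecidableEq m] (X Y : Matrix m n ℂ) :
    ∑ i, (of ![X i, Y i])ᴴ * of ![X i, Y i] = Xᴴ * X + Yᴴ * Y := by
  ext p q
  simp only [Matrix.sum_apply, Matrix.mul_apply, Fin.sum_univ_two, Matrix.add_apply,
    conjTranspose_apply, of_apply, cons_val_zero, cons_val_one, ← Finset.sum_add_distrib]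

open Matrix in
/-- Two reflections are simultaneously block diagonal with blocks of size two. -/
theorem exists_flip_of_reflections {m n : Type*} [Fintype m] [DecidableEq m]
    (A₀ A₁ : Matrix m m ℂ) (h₀ : A₀ᴴ = A₀) (h₁ : A₁ᴴ = A₁) (hs₀ : A₀ * A₀ = 1)
    (hs₁ : A₁ * A₁ = 1) (K : Matrix m n ℂ) :
    ∃ (u : m → ℂ) (V : m → Matrix (Fin 2) n ℂ), (∀ i, Complex.normSq (u i) = 1) ∧
      ∑ i, (V i)ᴴ * V i = 2 • (Kᴴ * K) ∧
      ∑ i, (V i)ᴴ * flipObs 1 * V i = 2 • (Kᴴ * A₀ * K) ∧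
      ∑ i, (V i)ᴴ * flipObs (u i) * V i = 2 • (Kᴴ * A₁ * K) := by
  -- Take U = A₀A₁. If Ue = ue, then A₁e = u A₀e and A₁A₀e = ūe, so on the pair e, A₀e the
  -- reflections act as `flipObs 1` and `flipObs u`.
  have hU : (A₀ * A₁)ᴴ * (A₀ * A₁) = 1 := by
    rw [conjTranspose_mul, h₀, h₁, mul_assoc, ← mul_assoc A₀, hs₀, one_mul, hs₁]
  obtain ⟨O, u, hO, -, hu, hd⟩ := exists_unitary_diagonalization hU
  have hd' : A₁ * A₀ = O * diagonal (star u) * Oᴴ := by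
    have := congrArg conjTranspose hd
    rwa [conjTranspose_mul, h₀, h₁, conjTranspose_mul, conjTranspose_mul,
      conjTranspose_conjTranspose, diagonal_conjTranspose, ← mul_assoc] at this
  have hOc : ∀ (k : Type _) (M : Matrix m k ℂ), O * (Oᴴ * M) = M := fun k M => by
    rw [← Matrix.mul_assoc, hO, Matrix.one_mul]
  have hA₀ : A₀ * (A₀ * K) = K := by rw [← Matrix.mul_assoc, hs₀, Matrix.one_mul]
  -- The rows of V i are the coordinates of K along eᵢ and A₀eᵢ. Both families are orthonormal
  -- bases, so everything is counted twice; hence the factor 2.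
  refine ⟨u, fun i => of ![(Oᴴ * K) i, (Oᴴ * (A₀ * K)) i], hu, ?_, ?_, ?_⟩
  · rw [sum_conj_one (Oᴴ * K) (Oᴴ * (A₀ * K))]
    simp only [conjTranspose_mul, conjTranspose_conjTranspose, h₀, Matrix.mul_assoc]
    rw [hOc, hOc, hA₀, two_smul]
  · rw [sum_conj_flipObs (Oᴴ * K) (Oᴴ * (A₀ * K)) fun _ => 1]
    rw [show (star fun _ : m => (1 : ℂ)) = fun _ => 1 by ext; simp]
    simp only [diagonal_one, Matrix.mul_one]
    simp only [conjTranspose_mul, conjTranspose_conjTranspose, h₀, Matrix.mul_assoc]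
    rw [hOc, hOc, two_smul]
  · rw [sum_conj_flipObs (Oᴴ * K) (Oᴴ * (A₀ * K)) u]
    simp only [conjTranspose_mul, conjTranspose_conjTranspose, h₀]
    have e1 : Kᴴ * O * diagonal (star u) * (Oᴴ * (A₀ * K)) = Kᴴ * (A₁ * A₀) * (A₀ * K) := by
      rw [hd']; simp only [Matrix.mul_assoc]
    have e2 : Kᴴ * A₀ * O * diagonal u * (Oᴴ * K) = Kᴴ * A₀ * (A₀ * A₁) * K := by
      rw [hd]; simp only [Matrix.mul_assoc]
    rw [e1, e2, two_smul]
    congr 1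
    · simp only [Matrix.mul_assoc, hA₀]
    · rw [← Matrix.mul_assoc, Matrix.mul_assoc Kᴴ A₀ A₀, hs₀, Matrix.mul_one]

open Matrix in
/-- The square root of `1 - T ^ 2` for a Hermitian contraction `T`. -/
theorem exists_sqrt_one_sub_sq {n : Type*} [Fintype n] [DecidableEq n] {T : Matrix n n ℂ}
    (h₁ : (1 - T).PosSemidef) (h₂ : (1 + T).PosSemidef) :
    ∃ S : Matrix n n ℂ, Sᴴ = S ∧ T * S = S * T ∧ T * T + S * S = 1 := by
  have hT : T.IsHermitian := by
    have := h₂.1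
    rw [IsHermitian, conjTranspose_add, conjTranspose_one] at this
    exact add_left_cancel this
  obtain ⟨O, hO⟩ : ∃ O : Matrix n n ℂ, O = hT.eigenvectorUnitary := ⟨_, rfl⟩
  obtain ⟨t, ht⟩ : ∃ t : n → ℝ, t = hT.eigenvalues := ⟨_, rfl⟩
  have hOO : Oᴴ * O = 1 := by rw [hO]; exact Unitary.coe_star_mul_self _
  have hOO' : O * Oᴴ = 1 := by rw [hO]; exact Unitary.coe_mul_star_self _
  have hd : T = O * diagonal (fun i => (t i : ℂ)) * Oᴴ := by
    have := hT.spectral_theorem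
    rw [Unitary.conjStarAlgAut_apply, ← hO] at this
    rw [ht]
    exact this
  have hc : Oᴴ * T * O = diagonal (fun i => (t i : ℂ)) := by
    rw [hd]
    calc Oᴴ * (O * diagonal (fun i => (t i : ℂ)) * Oᴴ) * O
        = (Oᴴ * O) * diagonal (fun i => (t i : ℂ)) * (Oᴴ * O) := by simp only [mul_assoc]
      _ = _ := by rw [hOO, one_mul, mul_one]
  -- Conjugating 1 ± T by the eigenvectors shows that each eigenvalue lies in [-1, 1].
  have hle : ∀ i, 0 ≤ 1 - t i * t i := by
    intro i
    have e₁ := (h₁.conjTranspose_mul_mul_same O).diag_nonneg (i := i)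
    have e₂ := (h₂.conjTranspose_mul_mul_same O).diag_nonneg (i := i)
    rw [mul_sub, sub_mul, mul_one, hOO, hc, Matrix.sub_apply, one_apply_eq, diagonal_apply_eq] at e₁
    rw [mul_add, add_mul, mul_one, hOO, hc, Matrix.add_apply, one_apply_eq, diagonal_apply_eq] at e₂
    have e₁' : 0 ≤ 1 - t i := by exact_mod_cast e₁
    have e₂' : 0 ≤ 1 + t i := by exact_mod_cast e₂
    nlinarith
  have hmul : ∀ f g : n → ℂ, (O * diagonal f * Oᴴ) * (O * diagonal g * Oᴴ) =
      O * diagonal (fun i => f i * g i) * Oᴴ := by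
    intro f g
    rw [← diagonal_mul_diagonal]
    calc (O * diagonal f * Oᴴ) * (O * diagonal g * Oᴴ)
        = O * diagonal f * (Oᴴ * O) * diagonal g * Oᴴ := by simp only [mul_assoc]
      _ = _ := by rw [hOO, mul_one]; simp only [mul_assoc]
  refine ⟨O * diagonal (fun i => (√(1 - t i * t i) : ℂ)) * Oᴴ, ?_, ?_, ?_⟩
  · rw [conjTranspose_mul, conjTranspose_mul, conjTranspose_conjTranspose,
      diagonal_conjTranspose, ← mul_assoc]
    congr 3
    ext i
    simp
  · rw [hd, hmul, hmul]
    simp only [mul_comm]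
  · rw [hd, hmul, hmul, ← add_mul, ← mul_add, diagonal_add]
    have : (fun i => (t i : ℂ) * t i + (√(1 - t i * t i) : ℂ) * √(1 - t i * t i)) = fun _ => 1 := by
      ext i
      rw [← Complex.ofReal_mul, ← Complex.ofReal_mul, Real.mul_self_sqrt (hle i)]
      push_cast
      ring
    rw [this, diagonal_one, mul_one, hOO']

open Matrix in
/-- Two two-outcome measurements are a compression of a direct sum of qubit measurements. -/
theorem exists_flip_decomposition {d : ℕ} (E : Fin 2 → Fin 2 → Matrix (Fin d) (Fin d) ℂ)
    (hE : ∀ x, IsMeasurement (E x)) :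
    ∃ (u : Fin d ⊕ Fin d → ℂ) (V : Fin d ⊕ Fin d → Matrix (Fin 2) (Fin d) ℂ),
      (∀ i, Complex.normSq (u i) = 1) ∧
      ∀ x a, E x a = ∑ i, (V i)ᴴ * flipEffect ![1, u i] x a * V i := by
  have hsum : ∀ x, E x 0 + E x 1 = 1 := fun x => by
    have := (hE x).2
    rwa [Fin.sum_univ_two] at this
  obtain ⟨J, hJ⟩ : ∃ J : Matrix (Fin d ⊕ Fin d) (Fin d) ℂ, J = fromRows 1 0 := ⟨_, rfl⟩
  have hdil : ∀ x, ∃ A : Matrix (Fin d ⊕ Fin d) (Fin d ⊕ Fin d) ℂ, Aᴴ = A ∧ A * A = 1 ∧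
      Jᴴ * A * J = E x 0 - E x 1 := by
    intro x
    have hT : (E x 0 - E x 1)ᴴ = E x 0 - E x 1 := by
      rw [conjTranspose_sub, ((hE x).1 0).1, ((hE x).1 1).1]
    have hp : (1 + (E x 0 - E x 1)).PosSemidef := by
      rw [← hsum x, show E x 0 + E x 1 + (E x 0 - E x 1) = E x 0 + E x 0 by abel]
      exact ((hE x).1 0).add ((hE x).1 0)
    have hm : (1 - (E x 0 - E x 1)).PosSemidef := by
      rw [← hsum x, show E x 0 + E x 1 - (E x 0 - E x 1) = E x 1 + E x 1 by abel]
      exact ((hE x).1 1).add ((hE x).1 1)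
    obtain ⟨S, hS, hTS, hTT⟩ := exists_sqrt_one_sub_sq hm hp
    -- Halmos dilation: with T = E₀ - E₁ and S² = 1 - T² commuting with T, the block matrix with
    -- rows (T, S) and (S, -T) is a reflection whose corner is T.
    refine ⟨fromBlocks (E x 0 - E x 1) S S (-(E x 0 - E x 1)), ?_, ?_, ?_⟩
    · rw [fromBlocks_conjTranspose, hT, hS, conjTranspose_neg, hT]
    · rw [fromBlocks_multiply, hTT, neg_mul_neg, add_comm (S * S), hTT, mul_neg, hTS, neg_mul, hTS,
        add_neg_cancel, fromBlocks_one]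
    · rw [hJ, conjTranspose_fromRows_eq_fromCols_conjTranspose, fromCols_mul_fromBlocks,
        fromCols_mul_fromRows]
      simp
  obtain ⟨A₀, h₀, hs₀, hc₀⟩ := hdil 0
  obtain ⟨A₁, h₁, hs₁, hc₁⟩ := hdil 1
  -- Rescaling the inclusion J by r = 1/√2 cancels the double counting.
  obtain ⟨r, hr⟩ : ∃ r : ℂ, r = ((√2)⁻¹ : ℝ) := ⟨_, rfl⟩
  have hrr : 2 * (star r * r) = 1 := by
    rw [hr, Complex.star_def, Complex.conj_ofReal, ← mul_assoc]
    exact_mod_cast sqrt_two_inv_spec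
  obtain ⟨u, V, hu, e, e₀, e₁⟩ := exists_flip_of_reflections A₀ A₁ h₀ h₁ hs₀ hs₁
    (r • J)
  have hscale : ∀ M : Matrix (Fin d) (Fin d) ℂ, 2 • (star r • r • M) = M := fun M => by
    rw [smul_smul, ← Nat.cast_smul_eq_nsmul ℂ, smul_smul]
    push_cast
    rw [hrr, one_smul]
  simp only [conjTranspose_smul, Matrix.smul_mul, Matrix.mul_smul] at e e₀ e₁
  have h1 : Jᴴ * J = 1 := by
    rw [hJ, conjTranspose_fromRows_eq_fromCols_conjTranspose, fromCols_mul_fromRows]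
    simp
  rw [h1, smul_comm r, hscale] at e
  rw [hc₀, smul_comm r, hscale] at e₀
  rw [hc₁, smul_comm r, hscale] at e₁
  refine ⟨u, V, hu, fun x a => ?_⟩
  have hx : ∑ i, (V i)ᴴ * flipObs ((![1, u i] : Fin 2 → ℂ) x) * V i = E x 0 - E x 1 := by
    fin_cases x
    · exact e₀
    · exact e₁
  have hEa : E x a = (1 / 2 : ℂ) • (1 + (sgn a : ℂ) • (E x 0 - E x 1)) := by
    rw [← hsum x]
    fin_cases a
    · simp only [sgn, Fin.zero_eta, pow_zero, Complex.ofReal_one, one_smul]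
      module
    · simp only [sgn, Fin.mk_one, pow_one, Complex.ofReal_neg, Complex.ofReal_one]
      module
  rw [hEa, ← hx, ← e, Finset.smul_sum, ← Finset.sum_add_distrib, Finset.smul_sum]
  refine Finset.sum_congr rfl fun i _ => ?_
  rw [flipEffect, Matrix.mul_smul, Matrix.smul_mul, Matrix.mul_add, Matrix.add_mul, Matrix.mul_one, Matrix.mul_smul, Matrix.smul_mul]

/-! ### Compactness -/

/-- In finite dimension the convex hull of a compact set is compact. -/
theorem isCompact_convexHull_of_isCompact {V : Type*} [NormedAddCommGroup V] [NormedSpace ℝ V]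
    [FiniteDimensional ℝ V] {s : Set V} (hs : IsCompact s) : IsCompact (convexHull ℝ s) := by
  -- By Carathéodory at most finrank + 1 points are needed, so k < finrank + 2. For fixed k the
  -- combinations are a continuous image of a simplex times a power of s.
  have heq : convexHull ℝ s = ⋃ k ∈ Finset.range (Module.finrank ℝ V + 2),
      (fun p : (Fin k → ℝ) × (Fin k → V) => ∑ i, p.1 i • p.2 i) ''
        (stdSimplex ℝ (Fin k) ×ˢ Set.univ.pi fun _ => s) := by
    ext x
    simp only [Set.mem_iUnion, Finset.mem_range]
    constructor
    · intro hx
      obtain ⟨ι, _, z, w, hz, haff, hw, hw1, rfl⟩ := eq_pos_convex_span_of_mem_convexHull hx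
      have hcard : Fintype.card ι ≤ Module.finrank ℝ V + 1 :=
        haff.card_le_finrank_succ.trans
          (Nat.add_le_add_right (Submodule.finrank_le _) 1)
      let e := Fintype.equivFin ι
      refine ⟨Fintype.card ι, by lia, ⟨fun i => w (e.symm i), fun i => z (e.symm i)⟩,
        ⟨⟨fun i => (hw _).le, ?_⟩, fun i _ => hz ⟨_, rfl⟩⟩, ?_⟩
      · rw [← hw1]
        exact Equiv.sum_comp e.symm w
      · exact Equiv.sum_comp e.symm fun i => w i • z i
    · rintro ⟨k, -, ⟨w, z⟩, ⟨⟨hw0, hw1⟩, hz⟩, rfl⟩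
      exact (convex_convexHull ℝ s).sum_mem (fun i _ => hw0 i) hw1
        fun i _ => subset_convexHull _ _ (hz i trivial)
  rw [heq]
  refine (Finset.finite_toSet _).isCompact_biUnion fun k _ => ?_
  refine ((isCompact_stdSimplex ℝ (Fin k)).prod (isCompact_univ_pi fun _ => hs)).image ?_
  fun_prop

/-- The behaviours of pure three-qubit strategies with observables `flipObs 1`, `flipObs u`. -/
def qubitSet : Set Behaviour :=
  (fun p : ℂ × ℂ × ℂ × (Fin 2 × Fin 2 × Fin 2 → ℂ) =>
    qubitBehaviour ![1, p.1] ![1, p.2.1] ![1, p.2.2.1] p.2.2.2) ''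
    ({u | Complex.normSq u = 1} ×ˢ {u | Complex.normSq u = 1} ×ˢ {u | Complex.normSq u = 1} ×ˢ
      {ψ | ∑ i, ∑ j, ∑ k, Complex.normSq (ψ (i, j, k)) = 1})

theorem continuous_flipEffect (x o i j : Fin 2) :
    Continuous fun u : ℂ => flipEffect ![1, u] x o i j := by
  fin_cases x <;> fin_cases i <;> fin_cases j <;> simp [flipEffect, flipObs] <;> fun_prop

theorem isCompact_normSq_eq_one : IsCompact {u : ℂ | Complex.normSq u = 1} := by
  refine (isCompact_closedBall (0 : ℂ) 1).of_isClosed_subset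
    (isClosed_eq Complex.continuous_normSq continuous_const) fun u hu => ?_
  rw [mem_closedBall_zero_iff, ← sq_le_one_iff₀ (norm_nonneg _), ← Complex.normSq_eq_norm_sq]
  exact (Set.mem_ofPred.1 hu).le

theorem isCompact_unit_vectors : IsCompact {ψ : Fin 2 × Fin 2 × Fin 2 → ℂ |
    ∑ i, ∑ j, ∑ k, Complex.normSq (ψ (i, j, k)) = 1} := by
  refine (isCompact_closedBall (0 : Fin 2 × Fin 2 × Fin 2 → ℂ) 1).of_isClosed_subset
    (isClosed_eq ?_ continuous_const) fun ψ hψ => ?_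
  · have := Complex.continuous_normSq
    fun_prop
  · rw [mem_closedBall_zero_iff, pi_norm_le_iff_of_nonneg zero_le_one]
    intro p
    rw [← sq_le_one_iff₀ (norm_nonneg _), ← Complex.normSq_eq_norm_sq, ← Set.mem_ofPred.1 hψ]
    have := Finset.single_le_sum (f := fun p => Complex.normSq (ψ p))
      (fun _ _ => Complex.normSq_nonneg _) (Finset.mem_univ p)
    simpa [Fintype.sum_prod_type] using this

theorem isCompact_qubitSet : IsCompact qubitSet := by
  refine (isCompact_normSq_eq_one.prod (isCompact_normSq_eq_one.prod
    (isCompact_normSq_eq_one.prod isCompact_unit_vectors))).image ?_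
  refine continuous_pi fun o => continuous_pi fun p => continuous_pi fun q =>
    continuous_pi fun x => continuous_pi fun y => continuous_pi fun z => ?_
  simp only [qubitBehaviour, bornBehaviour, trace_kronecker_mul_vecMulVec]
  have h := continuous_flipEffect
  refine Complex.continuous_re.comp ?_
  refine continuous_finsetSum _ fun i _ => continuous_finsetSum _ fun j _ =>
    continuous_finsetSum _ fun k _ => continuous_finsetSum _ fun i' _ =>
    continuous_finsetSum _ fun j' _ => continuous_finsetSum _ fun k' _ => ?_
  have h1 := (h x o i i').comp (continuous_fst :
    Continuous fun p : ℂ × ℂ × ℂ × (Fin 2 × Fin 2 × Fin 2 → ℂ) => p.1)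
  have h2 := (h y p j j').comp (continuous_fst.comp continuous_snd :
    Continuous fun p : ℂ × ℂ × ℂ × (Fin 2 × Fin 2 × Fin 2 → ℂ) => p.2.1)
  have h3 := (h z q k k').comp (continuous_fst.comp (continuous_snd.comp continuous_snd) :
    Continuous fun p : ℂ × ℂ × ℂ × (Fin 2 × Fin 2 × Fin 2 → ℂ) => p.2.2.1)
  refine ((((h1.mul h2).mul h3).mul ?_).mul ?_)
  · fun_prop
  · fun_prop

/-! ### Quantum behaviours as mixtures of qubit behaviours -/

theorem qubitBehaviour_smul (r : ℝ) (a b c : Fin 2 → ℂ) (ψ : Fin 2 × Fin 2 × Fin 2 → ℂ) :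
    qubitBehaviour a b c ((r : ℂ) • ψ) = (r * r) • qubitBehaviour a b c ψ := by
  funext o p q x y z
  simp only [qubitBehaviour, bornBehaviour, Pi.smul_apply, smul_eq_mul]
  rw [star_smul, Matrix.smul_vecMulVec, Matrix.vecMulVec_smul, smul_smul, Matrix.mul_smul,
    Matrix.trace_smul, Complex.star_def, Complex.conj_ofReal, ← Complex.ofReal_mul, smul_eq_mul,
    Complex.re_ofReal_mul]

/-- The squared norm of a three-qubit vector. -/
def vecNormSq (ψ : Fin 2 × Fin 2 × Fin 2 → ℂ) : ℝ := ∑ i, ∑ j, ∑ k, Complex.normSq (ψ (i, j, k))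

theorem vecNormSq_nonneg (ψ : Fin 2 × Fin 2 × Fin 2 → ℂ) : 0 ≤ vecNormSq ψ :=
  Finset.sum_nonneg fun _ _ => Finset.sum_nonneg fun _ _ => Finset.sum_nonneg fun _ _ =>
    Complex.normSq_nonneg _

theorem exists_qubitSet_smul {u v w : ℂ} (hu : Complex.normSq u = 1) (hv : Complex.normSq v = 1)
    (hw : Complex.normSq w = 1) (ψ : Fin 2 × Fin 2 × Fin 2 → ℂ) :
    ∃ Q ∈ qubitSet, qubitBehaviour ![1, u] ![1, v] ![1, w] ψ = vecNormSq ψ • Q := by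
  rcases (vecNormSq_nonneg ψ).eq_or_lt with h | h
  · refine ⟨_, ⟨⟨u, v, w, Pi.single (0, 0, 0) 1⟩, ⟨hu, hv, hw, ?_⟩, rfl⟩, ?_⟩
    · simp [Fin.sum_univ_two]
    · have h0 : ψ = ((0 : ℝ) : ℂ) • ψ := by
        have h1 : ∑ p, Complex.normSq (ψ p) = 0 := by
          rw [h]; simp [vecNormSq, Fintype.sum_prod_type]
        funext p
        have := (Finset.sum_eq_zero_iff_of_nonneg
          (fun _ _ => Complex.normSq_nonneg _)).1 h1 p (Finset.mem_univ p)
        simpa using this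
      rw [h0, qubitBehaviour_smul, ← h0, ← h, zero_mul, zero_smul, zero_smul]
  · have hs : √(vecNormSq ψ) ≠ 0 := by positivity
    refine ⟨_, ⟨⟨u, v, w, (((√(vecNormSq ψ))⁻¹ : ℝ) : ℂ) • ψ⟩, ⟨hu, hv, hw, ?_⟩, rfl⟩, ?_⟩
    · simp only [Set.mem_ofPred_eq, Pi.smul_apply, smul_eq_mul, map_mul, Complex.normSq_ofReal,
        ← Finset.mul_sum]
      change _ * vecNormSq ψ = 1
      rw [← mul_inv, Real.mul_self_sqrt h.le, inv_mul_cancel₀ h.ne']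
    · simp only
      rw [qubitBehaviour_smul, smul_smul, ← mul_inv, Real.mul_self_sqrt h.le,
        mul_inv_cancel₀ h.ne', one_smul]

open Matrix in
theorem sum_trace_kronecker {l m n : Type*} [Fintype l] [Fintype m] [Fintype n] [DecidableEq l]
    [DecidableEq m] [DecidableEq n] {E : Fin 2 → Matrix l l ℂ} {F : Fin 2 → Matrix m m ℂ}
    {G : Fin 2 → Matrix n n ℂ} (hE : ∑ a, E a = 1) (hF : ∑ b, F b = 1) (hG : ∑ c, G c = 1)
    (ρ : Matrix (l × m × n) (l × m × n) ℂ) :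
    ∑ a, ∑ b, ∑ c, ((E a ⊗ₖ (F b ⊗ₖ G c)) * ρ).trace = ρ.trace := by
  rw [Fin.sum_univ_two] at hE hF hG
  simp only [Fin.sum_univ_two, ← trace_add, ← Matrix.add_mul, ← kronecker_add, ← add_kronecker,
    hE, hF, hG, one_kronecker_one, Matrix.one_mul]

theorem sum_flipEffect (a : Fin 2 → ℂ) (x : Fin 2) : ∑ o, flipEffect a x o = 1 := by
  simp only [Fin.sum_univ_two, flipEffect, sgn, Fin.val_zero, Fin.val_one, pow_zero, pow_one,
    Complex.ofReal_one, Complex.ofReal_neg]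
  module

theorem trace_vecMulVec_star (ψ : Fin 2 × Fin 2 × Fin 2 → ℂ) :
    (Matrix.vecMulVec ψ (star ψ)).trace = vecNormSq ψ := by
  simp [Matrix.trace, Matrix.vecMulVec_apply, Fintype.sum_prod_type, vecNormSq, Complex.mul_conj]

open Matrix in
/-- Compressing all three parties. -/
theorem trace_kronecker_compression {d : ℕ} {I J K : Type*} [Fintype I] [Fintype J] [Fintype K]
    (V : I → Matrix (Fin 2) (Fin d) ℂ) (W : J → Matrix (Fin 2) (Fin d) ℂ)
    (X : K → Matrix (Fin 2) (Fin d) ℂ) (e : I → Matrix (Fin 2) (Fin 2) ℂ)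
    (f : J → Matrix (Fin 2) (Fin 2) ℂ) (g : K → Matrix (Fin 2) (Fin 2) ℂ)
    (φ : Fin d × Fin d × Fin d → ℂ) :
    (((∑ i, (V i)ᴴ * e i * V i) ⊗ₖ ((∑ j, (W j)ᴴ * f j * W j) ⊗ₖ (∑ k, (X k)ᴴ * g k * X k))) *
      vecMulVec φ (star φ)).trace =
    ∑ i, ∑ j, ∑ k, ((e i ⊗ₖ (f j ⊗ₖ g k)) *
      vecMulVec ((V i ⊗ₖ (W j ⊗ₖ X k)) *ᵥ φ) (star ((V i ⊗ₖ (W j ⊗ₖ X k)) *ᵥ φ))).trace := by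
  have hsum : (∑ i, (V i)ᴴ * e i * V i) ⊗ₖ
      ((∑ j, (W j)ᴴ * f j * W j) ⊗ₖ (∑ k, (X k)ᴴ * g k * X k)) =
      ∑ i, ∑ j, ∑ k, ((V i)ᴴ * e i * V i) ⊗ₖ (((W j)ᴴ * f j * W j) ⊗ₖ ((X k)ᴴ * g k * X k)) := by
    ext ⟨a, b, c⟩ ⟨a', b', c'⟩
    simp only [kroneckerMap_apply, Matrix.sum_apply, Finset.sum_mul_sum]
    simp only [Finset.mul_sum]
  rw [hsum]
  simp only [Matrix.sum_mul, trace_sum]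
  refine Finset.sum_congr rfl fun i _ => Finset.sum_congr rfl fun j _ =>
    Finset.sum_congr rfl fun k _ => ?_
  rw [mul_kronecker_mul, mul_kronecker_mul, mul_kronecker_mul, mul_kronecker_mul,
    ← conjTranspose_kronecker, ← conjTranspose_kronecker, star_mulVec, ← vecMulVec_mul,
    ← mul_vecMulVec, Matrix.mul_assoc, Matrix.mul_assoc, trace_mul_comm]
  simp only [Matrix.mul_assoc]

theorem quantumFinite_subset : quantumFinite ⊆ convexHull ℝ qubitSet := by
  rintro P ⟨d, ρ, E, F, G, ⟨hρ, hρ1⟩, ⟨hE, hF, hG⟩, hP⟩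
  obtain ⟨u, V, hu, hV⟩ := exists_flip_decomposition E hE
  obtain ⟨v, W, hv, hW⟩ := exists_flip_decomposition F hF
  obtain ⟨w, X, hw, hX⟩ := exists_flip_decomposition G hG
  obtain ⟨m, φ, rfl⟩ := Matrix.posSemidef_iff_eq_sum_vecMulVec.1 hρ
  -- An index t selects one pure component of the state and one qubit summand for each party.
  choose Q hQ hQeq using fun t : Fin m × (Fin d ⊕ Fin d) × (Fin d ⊕ Fin d) × (Fin d ⊕ Fin d) =>
    exists_qubitSet_smul (hu t.2.1) (hv t.2.2.1) (hw t.2.2.2)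
      ((V t.2.1 ⊗ₖ (W t.2.2.1 ⊗ₖ X t.2.2.2)).mulVec (φ t.1))
  have hPsum : P = ∑ t : Fin m × (Fin d ⊕ Fin d) × (Fin d ⊕ Fin d) × (Fin d ⊕ Fin d),
      qubitBehaviour ![1, u t.2.1] ![1, v t.2.2.1] ![1, w t.2.2.2]
        ((V t.2.1 ⊗ₖ (W t.2.2.1 ⊗ₖ X t.2.2.2)).mulVec (φ t.1)) := by
    funext a b c x y z
    have h := congrArg Complex.re (hP a b c x y z)
    rw [Complex.ofReal_re, Matrix.mul_sum, Matrix.trace_sum, hV, hW, hX] at h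
    simp only [trace_kronecker_compression] at h
    rw [h]
    simp only [Finset.sum_apply, Fintype.sum_prod_type, Complex.re_sum]
    rfl
  have hP1 : ∑ a, ∑ b, ∑ c, P a b c 0 0 0 = 1 := by
    rw [← Complex.ofReal_inj, Complex.ofReal_one, ← hρ1,
      ← sum_trace_kronecker (hE 0).2 (hF 0).2 (hG 0).2]
    push_cast
    simp only [hP]
  have hw1 : ∑ t : Fin m × (Fin d ⊕ Fin d) × (Fin d ⊕ Fin d) × (Fin d ⊕ Fin d),
      vecNormSq ((V t.2.1 ⊗ₖ (W t.2.2.1 ⊗ₖ X t.2.2.2)).mulVec (φ t.1)) = 1 := by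
    -- The squared norm of an unnormalised vector is its total probability, so the weights add up to
    -- the normalisation of P; settings 0, 0, 0 suffice.
    have hq : ∀ a b c ψ, ∑ o, ∑ p, ∑ q, qubitBehaviour a b c ψ o p q 0 0 0 = vecNormSq ψ := by
      intro a b c ψ
      have := congrArg Complex.re (sum_trace_kronecker (sum_flipEffect a 0) (sum_flipEffect b 0)
        (sum_flipEffect c 0) (Matrix.vecMulVec ψ (star ψ)))
      simp only [trace_vecMulVec_star, Complex.re_sum, Complex.ofReal_re] at this
      exact this
    rw [← hP1, hPsum]
    simp only [Finset.sum_apply, Fin.sum_univ_two, ← Finset.sum_add_distrib]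
    refine Finset.sum_congr rfl fun t _ => ?_
    rw [← hq ![1, u t.2.1] ![1, v t.2.2.1] ![1, w t.2.2.2]]
    simp only [Fin.sum_univ_two]
  rw [hPsum]
  simp only [hQeq]
  exact (convex_convexHull ℝ _).sum_mem (fun _ _ => vecNormSq_nonneg _) hw1
    fun t _ => subset_convexHull _ _ (hQ t)

theorem quantumSet_subset : quantumSet ⊆ convexHull ℝ qubitSet :=
  closure_minimal quantumFinite_subset
    (isCompact_convexHull_of_isCompact isCompact_qubitSet).isClosed

/-! ### The Bell functional and its maximisers in a convex hull -/

theorem corr_add (P Q : Behaviour) (x y z : Fin 2) :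
    corr (P + Q) x y z = corr P x y z + corr Q x y z := by
  simp only [corr, Pi.add_apply, mul_add, Finset.sum_add_distrib]

theorem corr_smul (r : ℝ) (P : Behaviour) (x y z : Fin 2) :
    corr (r • P) x y z = r * corr P x y z := by
  simp only [corr, Pi.smul_apply, smul_eq_mul, Finset.mul_sum]
  simp only [mul_left_comm]

theorem isLinearMap_bellB8 : IsLinearMap ℝ bellB8 where
  map_add P Q := by simp only [bellB8, corr_add]; ring
  map_smul r P := by simp only [bellB8, corr_smul, smul_eq_mul]; ring

theorem qubitSet_bellB8_le {P : Behaviour} (hP : P ∈ qubitSet) :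
    bellB8 P ≤ 2 * √2 ∧ (bellB8 P = 2 * √2 → P ∈ faceHull) := by
  obtain ⟨⟨u, v, w, ψ⟩, ⟨hu, hv, hw, hψ⟩, rfl⟩ := hP
  simp only [Set.mem_ofPred_eq] at hu hv hw hψ
  dsimp only
  rw [qubitBehaviour_eq_toBehaviour _ _ _ _ (normSq_to_mul_star hψ)]
  refine ⟨?_, qubitExp_mem_faceHull hu hv hw hψ⟩
  rw [← sub_nonneg, bellB8_qubitExp hu hv hw hψ]
  exact Finset.sum_nonneg fun _ _ => Finset.sum_nonneg fun _ _ =>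
    mul_nonneg (Real.sqrt_nonneg _) (add_nonneg (Complex.normSq_nonneg _)
      (Complex.normSq_nonneg _))

/-- Points of a convex hull that maximise a linear function are in the hull of the maximisers. -/
theorem mem_convexHull_of_max {V : Type*} [AddCommGroup V] [Module ℝ V] {s t : Set V}
    {f : V → ℝ} (hf : IsLinearMap ℝ f) {M : ℝ} (ht : Convex ℝ t)
    (hs : ∀ p ∈ s, f p ≤ M ∧ (f p = M → p ∈ t)) {p : V} (hp : p ∈ convexHull ℝ s) :
    f p ≤ M ∧ (f p = M → p ∈ t) := by
  have hconv : Convex ℝ {p | f p ≤ M ∧ (f p = M → p ∈ t)} := by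
    rintro p ⟨hp1, hp2⟩ q ⟨hq1, hq2⟩ a b ha hb hab
    have hfab : f (a • p + b • q) = a * f p + b * f q := by
      rw [hf.map_add, hf.map_smul, hf.map_smul, smul_eq_mul, smul_eq_mul]
    rcases ha.eq_or_lt with rfl | ha
    · rw [zero_add] at hab
      subst hab
      rw [zero_smul, one_smul, zero_add]
      exact ⟨hq1, hq2⟩
    rcases hb.eq_or_lt with rfl | hb
    · rw [add_zero] at hab
      subst hab
      rw [zero_smul, one_smul, add_zero]
      exact ⟨hp1, hp2⟩
    -- With both weights positive, the value M at the mixture forces the value M at both endpoints.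
    have h1 := mul_le_mul_of_nonneg_left hp1 ha.le
    have h2 := mul_le_mul_of_nonneg_left hq1 hb.le
    have h3 : a * M + b * M = M := by rw [← add_mul, hab, one_mul]
    refine ⟨by rw [hfab]; linarith, fun h => ?_⟩
    rw [hfab] at h
    refine ht (hp2 ?_) (hq2 ?_) ha.le hb.le hab
    · exact mul_left_cancel₀ ha.ne' (by linarith)
    · exact mul_left_cancel₀ hb.ne' (by linarith)
  exact convexHull_min hs hconv hp

theorem quantumSet_bellB8_le {P : Behaviour} (hP : P ∈ quantumSet) :
    bellB8 P ≤ 2 * √2 ∧ (bellB8 P = 2 * √2 → P ∈ faceHull) :=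
  mem_convexHull_of_max isLinearMap_bellB8 (convex_convexHull ℝ _)
    (fun _ => qubitSet_bellB8_le) (quantumSet_subset hP)

/-! ### Convexity of the quantum set -/

open Matrix in
/-- The inclusions of the summands of `ℂ^(m + n) = ℂ^m ⊕ ℂ^n`. -/
theorem exists_summand_inclusions (m n : ℕ) :
    ∃ (J : Matrix (Fin (m + n)) (Fin m) ℂ) (K : Matrix (Fin (m + n)) (Fin n) ℂ),
      Jᴴ * J = 1 ∧ Kᴴ * K = 1 ∧ Jᴴ * K = 0 ∧ Kᴴ * J = 0 ∧ J * Jᴴ + K * Kᴴ = 1 := by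
  have hne : ∀ (i : Fin m) (j : Fin n), Fin.castAdd n i ≠ Fin.natAdd m j := by
    intro i j h
    have := congrArg Fin.val h
    simp only [Fin.val_castAdd, Fin.val_natAdd] at this
    lia
  refine ⟨(1 : Matrix (Fin (m + n)) (Fin (m + n)) ℂ).submatrix id (Fin.castAdd n),
    (1 : Matrix (Fin (m + n)) (Fin (m + n)) ℂ).submatrix id (Fin.natAdd m), ?_, ?_, ?_, ?_, ?_⟩
  · ext i j
    simp [Matrix.mul_apply, one_apply]
  · ext i j
    simp [Matrix.mul_apply, one_apply]
  · ext i j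
    simp [Matrix.mul_apply, one_apply, hne]
  · ext i j
    simp [Matrix.mul_apply, one_apply, fun i j => (hne i j).symm]
  · ext i j
    simp only [Matrix.add_apply, Matrix.mul_apply, submatrix_apply, conjTranspose_apply]
    -- Writing the identity as 1 * 1 turns its entries into sums over `Fin (m + n)`, which split
    -- into the contributions of J and K.
    rw [← Matrix.mul_one (1 : Matrix (Fin (m + n)) (Fin (m + n)) ℂ), Matrix.mul_apply,
      Fin.sum_univ_add]
    simp [one_apply, eq_comm]

open Matrix in
theorem trace_kronecker_conj {m n : Type*} [Fintype m] [Fintype n] (J : Matrix m n ℂ)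
    (X Y Z : Matrix m m ℂ) (ρ : Matrix (n × n × n) (n × n × n) ℂ) :
    ((X ⊗ₖ (Y ⊗ₖ Z)) * ((J ⊗ₖ (J ⊗ₖ J)) * ρ * (J ⊗ₖ (J ⊗ₖ J))ᴴ)).trace =
      (((Jᴴ * X * J) ⊗ₖ ((Jᴴ * Y * J) ⊗ₖ (Jᴴ * Z * J))) * ρ).trace := by
  rw [mul_kronecker_mul, mul_kronecker_mul, mul_kronecker_mul, mul_kronecker_mul,
    ← conjTranspose_kronecker, ← conjTranspose_kronecker, ← Matrix.mul_assoc, trace_mul_comm]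
  simp only [Matrix.mul_assoc]

-- The parties measure on direct sums of their local spaces, and the weighted states sit on the two
-- blocks where all three parties are in the same summand. The summand acts as shared randomness, so
-- the behaviours mix with weights s and t.
open Matrix in
theorem convex_quantumFinite : Convex ℝ quantumFinite := by
  rintro P ⟨d, ρ, E, F, G, ⟨hρ, hρ1⟩, ⟨hE, hF, hG⟩, hP⟩ Q
    ⟨d', ρ', E', F', G', ⟨hρ', hρ1'⟩, ⟨hE', hF', hG'⟩, hQ⟩ s t hs ht hst
  obtain ⟨J, K, hJJ, hKK, hJK, hKJ, hJK1⟩ := exists_summand_inclusions d d'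
  have hmeas : ∀ {E : Fin 2 → Matrix (Fin d) (Fin d) ℂ} {E' : Fin 2 → Matrix (Fin d') (Fin d') ℂ},
      IsMeasurement E → IsMeasurement E' →
      IsMeasurement fun a => J * E a * Jᴴ + K * E' a * Kᴴ := by
    intro E E' h h'
    refine ⟨fun a => ((h.1 a).mul_mul_conjTranspose_same J).add
      ((h'.1 a).mul_mul_conjTranspose_same K), ?_⟩
    rw [Finset.sum_add_distrib, ← Matrix.sum_mul, ← Matrix.mul_sum, h.2, ← Matrix.sum_mul,
      ← Matrix.mul_sum, h'.2, Matrix.mul_one, Matrix.mul_one, hJK1]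
  have hJc : ∀ (X : Matrix (Fin d) (Fin d) ℂ) (X' : Matrix (Fin d') (Fin d') ℂ),
      Jᴴ * (J * X * Jᴴ + K * X' * Kᴴ) * J = X := by
    intro X X'
    calc Jᴴ * (J * X * Jᴴ + K * X' * Kᴴ) * J
        = (Jᴴ * J) * X * (Jᴴ * J) + (Jᴴ * K) * X' * (Kᴴ * J) := by
          simp only [Matrix.mul_add, Matrix.add_mul, Matrix.mul_assoc]
      _ = X := by simp [hJJ, hJK]
  have hKc : ∀ (X : Matrix (Fin d) (Fin d) ℂ) (X' : Matrix (Fin d') (Fin d') ℂ),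
      Kᴴ * (J * X * Jᴴ + K * X' * Kᴴ) * K = X' := by
    intro X X'
    calc Kᴴ * (J * X * Jᴴ + K * X' * Kᴴ) * K
        = (Kᴴ * J) * X * (Jᴴ * K) + (Kᴴ * K) * X' * (Kᴴ * K) := by
          simp only [Matrix.mul_add, Matrix.add_mul, Matrix.mul_assoc]
      _ = X' := by simp [hKK, hKJ]
  have hs' : (0 : ℂ) ≤ s := by exact_mod_cast hs
  have ht' : (0 : ℂ) ≤ t := by exact_mod_cast ht
  refine ⟨d + d', (s : ℂ) • ((J ⊗ₖ (J ⊗ₖ J)) * ρ * (J ⊗ₖ (J ⊗ₖ J))ᴴ) +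
      (t : ℂ) • ((K ⊗ₖ (K ⊗ₖ K)) * ρ' * (K ⊗ₖ (K ⊗ₖ K))ᴴ),
    fun x a => J * E x a * Jᴴ + K * E' x a * Kᴴ, fun x a => J * F x a * Jᴴ + K * F' x a * Kᴴ,
    fun x a => J * G x a * Jᴴ + K * G' x a * Kᴴ, ⟨?_, ?_⟩,
    ⟨fun x => hmeas (hE x) (hE' x), fun x => hmeas (hF x) (hF' x),
      fun x => hmeas (hG x) (hG' x)⟩, ?_⟩
  · exact ((hρ.mul_mul_conjTranspose_same _).smul hs').add
      ((hρ'.mul_mul_conjTranspose_same _).smul ht')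
  · have h1 := trace_kronecker_conj J 1 1 1 ρ
    have h2 := trace_kronecker_conj K 1 1 1 ρ'
    simp only [one_kronecker_one, Matrix.one_mul, Matrix.mul_one, hJJ, hKK] at h1 h2
    rw [trace_add, trace_smul, trace_smul, h1, h2, hρ1, hρ1', smul_eq_mul, smul_eq_mul, mul_one,
      mul_one]
    exact_mod_cast hst
  · intro a b c x y z
    rw [Matrix.mul_add, trace_add, Matrix.mul_smul, Matrix.mul_smul, trace_smul, trace_smul,
      trace_kronecker_conj, trace_kronecker_conj, hJc, hJc, hJc, hKc, hKc, hKc, ← hP, ← hQ]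
    simp

theorem quantumFinite_subset_quantumSet : quantumFinite ⊆ quantumSet := subset_closure

theorem convex_quantumSet : Convex ℝ quantumSet := convex_quantumFinite.closure

/-! ### Qubit strategies are quantum -/

open Matrix in
theorem isMeasurement_flipEffect {a : Fin 2 → ℂ} (ha : ∀ x, Complex.normSq (a x) = 1)
    (x : Fin 2) : IsMeasurement (flipEffect a x) := by
  refine ⟨fun o => ?_, sum_flipEffect a x⟩
  have hherm : (flipEffect a x o)ᴴ = flipEffect a x o := by
    ext i j
    fin_cases i <;> fin_cases j <;> simp [flipEffect, flipObs, conjTranspose_apply]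
  have hsq : flipObs (a x) * flipObs (a x) = 1 := by
    have h := ha x
    have h' : a x * star (a x) = 1 := by
      rw [Complex.star_def, Complex.mul_conj, h, Complex.ofReal_one]
    ext i j
    fin_cases i <;> fin_cases j <;>
      simp only [flipObs, Matrix.mul_apply, Fin.sum_univ_two] <;> simp <;>
      first | exact h' | exact (mul_comm _ _).trans h'
  have hs : (sgn o : ℂ) * sgn o = 1 := by
    fin_cases o <;> simp [sgn]
  -- The observable squares to 1, so its effects are projections, hence of the form MᴴM.
  have hidem : flipEffect a x o = (flipEffect a x o)ᴴ * flipEffect a x o := by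
    rw [hherm, flipEffect, Matrix.smul_mul, Matrix.mul_smul, mul_add, add_mul, add_mul,
      Matrix.smul_mul, Matrix.smul_mul, Matrix.mul_smul, Matrix.mul_smul, hsq,
      smul_smul (sgn o : ℂ), hs]
    simp only [Matrix.mul_one, Matrix.one_mul]
    module
  rw [hidem]
  exact posSemidef_conjTranspose_mul_self _

-- `Generates` asks for an equality in ℂ, while `bornBehaviour` keeps only the real part.
open Matrix in
theorem trace_mul_eq_ofReal_re {n : Type*} [Fintype n] {M ρ : Matrix n n ℂ} (hM : Mᴴ = M)
    (hρ : ρᴴ = ρ) : (M * ρ).trace = ((M * ρ).trace.re : ℂ) := by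
  refine (Complex.conj_eq_iff_re.1 ?_).symm
  rw [← Complex.star_def, ← trace_conjTranspose, conjTranspose_mul, hM, hρ, trace_mul_comm]

theorem generates_qubit {a b c : Fin 2 → ℂ} (ha : ∀ x, Complex.normSq (a x) = 1)
    (hb : ∀ x, Complex.normSq (b x) = 1) (hc : ∀ x, Complex.normSq (c x) = 1)
    {ψ : Fin 2 × Fin 2 × Fin 2 → ℂ} (hψ : vecNormSq ψ = 1) :
    Generates (Matrix.vecMulVec ψ (star ψ)) (flipEffect a) (flipEffect b) (flipEffect c)
      (qubitExp a b c ψ).toBehaviour := by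
  refine ⟨⟨Matrix.posSemidef_vecMulVec_self_star ψ, by rw [trace_vecMulVec_star, hψ]; simp⟩,
    ⟨isMeasurement_flipEffect ha, isMeasurement_flipEffect hb, isMeasurement_flipEffect hc⟩,
    fun o p q x y z => ?_⟩
  rw [← qubitBehaviour_eq_toBehaviour _ _ _ _ (normSq_to_mul_star hψ)]
  refine (trace_mul_eq_ofReal_re ?_ (Matrix.posSemidef_vecMulVec_self_star ψ).1).symm
  rw [Matrix.conjTranspose_kronecker, Matrix.conjTranspose_kronecker,
    ((isMeasurement_flipEffect ha x).1 o).1, ((isMeasurement_flipEffect hb y).1 p).1,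
    ((isMeasurement_flipEffect hc z).1 q).1]

theorem qubitExp_mem_quantumFinite {a b c : Fin 2 → ℂ} (ha : ∀ x, Complex.normSq (a x) = 1)
    (hb : ∀ x, Complex.normSq (b x) = 1) (hc : ∀ x, Complex.normSq (c x) = 1)
    {ψ : Fin 2 × Fin 2 × Fin 2 → ℂ} (hψ : vecNormSq ψ = 1) :
    (qubitExp a b c ψ).toBehaviour ∈ quantumFinite ∧
      swapBC (qubitExp a b c ψ).toBehaviour ∈ quantumFinite := by
  refine ⟨⟨2, _, _, _, _, generates_qubit ha hb hc hψ⟩, ?_⟩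
  rw [swapBC_qubitExp]
  refine ⟨2, _, _, _, _, generates_qubit ha hc hb ?_⟩
  rw [← hψ]
  refine Finset.sum_congr rfl fun i _ => ?_
  rw [Finset.sum_comm]

theorem vecNormSq_doubleBlock {κ : ℂ} (hκ : Complex.normSq κ = 1) (j : Fin 2) {x : Fin 2 → ℂ}
    (hx : Complex.normSq (x 0) + Complex.normSq (x 1) = 1 / 2) :
    vecNormSq (doubleBlock κ j x) = 1 := by
  fin_cases j <;> simp [vecNormSq, doubleBlock, Fin.sum_univ_two, hκ] <;> linarith

theorem normSq_one_cons {u : ℂ} (hu : Complex.normSq u = 1) (x : Fin 2) :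
    Complex.normSq ((![1, u] : Fin 2 → ℂ) x) = 1 := by
  fin_cases x <;> simp [hu]

/-- With σ = ±1 one weight vanishes, so the four sign choices give P₁, …, P₄. The vector has x =
(1/2, σ/2), whose overlap c in `doubleBlock_eq_mixture` is exactly σ. -/
theorem point_mem_quantumFinite (η σ : ℝ) (hη : η = 1 ∨ η = -1) (hσ : σ = 1 ∨ σ = -1) :
    (((1 + σ) / 2) • (if η = 1 then point1 else point3) +
      ((1 - σ) / 2) • (if η = 1 then point2 else point4)) ∈ quantumFinite ∧
    swapBC (((1 + σ) / 2) • (if η = 1 then point1 else point3) +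
      ((1 - σ) / 2) • (if η = 1 then point2 else point4)) ∈ quantumFinite := by
  have hη1 : Complex.normSq (η : ℂ) = 1 := by
    rcases hη with rfl | rfl <;> simp
  have hσ2 : σ * σ = 1 := by rcases hσ with rfl | rfl <;> norm_num
  have hx : Complex.normSq ((![1 / 2, (σ : ℂ) / 2] : Fin 2 → ℂ) 0) +
      Complex.normSq ((![1 / 2, (σ : ℂ) / 2] : Fin 2 → ℂ) 1) = 1 / 2 := by
    simp [hσ2]
    norm_num
  have h := doubleBlock_eq_mixture (ε := 1) (Or.inl rfl) hη 0 hx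
    (v := η * ((1 : ℝ) * Complex.I)) (by simp [flipPhase])
  have hσ' : 4 * ((![1 / 2, (σ : ℂ) / 2] : Fin 2 → ℂ) 0 *
      star ((![1 / 2, (σ : ℂ) / 2] : Fin 2 → ℂ) 1)).re = σ := by
    simp
    ring
  rw [hσ'] at h
  rw [← h]
  refine qubitExp_mem_quantumFinite (normSq_one_cons (by simp)) (normSq_one_cons ?_)
    (normSq_one_cons hη1) (vecNormSq_doubleBlock (normSq_qubit_phase (by norm_num)) 0 hx)
  rw [map_mul, hη1]
  simp

theorem points_mem_quantumFinite (i : Fin 8) : points i ∈ quantumFinite := by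
  have h1 := point_mem_quantumFinite 1 1 (Or.inl rfl) (Or.inl rfl)
  have h2 := point_mem_quantumFinite 1 (-1) (Or.inl rfl) (Or.inr rfl)
  have h3 := point_mem_quantumFinite (-1) 1 (Or.inr rfl) (Or.inl rfl)
  have h4 := point_mem_quantumFinite (-1) (-1) (Or.inr rfl) (Or.inr rfl)
  have hne : ¬ (-1 : ℝ) = 1 := by norm_num
  have e1 : (1 + 1 : ℝ) / 2 = 1 := by norm_num
  have e2 : (1 + -1 : ℝ) / 2 = 0 := by norm_num
  have e3 : (1 - -1 : ℝ) / 2 = 1 := by norm_num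
  have e4 : (1 - 1 : ℝ) / 2 = 0 := by norm_num
  simp only [if_true, if_neg hne, e1, e2, e3, e4, one_smul, zero_smul, add_zero, zero_add]
    at h1 h2 h3 h4
  fin_cases i
  exacts [h1.1, h2.1, h3.1, h4.1, h1.2, h2.2, h3.2, h4.2]

/-! ### Bell values of the extremal points, the GHZ strategies and the face -/

theorem bellB8_swapBC (P : Behaviour) : bellB8 (swapBC P) = bellB8 P := by
  have h : ∀ x y z, corr (swapBC P) x y z = corr P x z y := by
    intro x y z
    refine Finset.sum_congr rfl fun a _ => ?_
    rw [Finset.sum_comm]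
    refine Finset.sum_congr rfl fun b _ => Finset.sum_congr rfl fun c _ => ?_
    rw [swapBC, mul_right_comm (sgn a)]
  simp only [bellB8, h]

theorem four_div_sqrt_two : 4 * (√2)⁻¹ = 2 * √2 := by
  have h1 : √2 * √2 = (2 : ℝ) := Real.mul_self_sqrt (by norm_num)
  have h2 : √2 * (√2)⁻¹ = (1 : ℝ) := mul_inv_cancel₀ (by positivity)
  linear_combination (-2 * (√2)⁻¹) * h1 + (2 * √2) * h2

theorem bellB8_points (i : Fin 8) : bellB8 (points i) = 2 * √2 := by
  have h1 : bellB8 point1 = 2 * √2 := by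
    simp [point1, bellB8_toBehaviour, ← four_div_sqrt_two, div_eq_mul_inv]
    ring
  have h2 : bellB8 point2 = 2 * √2 := by
    simp [point2, bellB8_toBehaviour, ← four_div_sqrt_two, div_eq_mul_inv]
    ring
  have h3 : bellB8 point3 = 2 * √2 := by
    simp [point3, bellB8_toBehaviour, ← four_div_sqrt_two, div_eq_mul_inv]
    ring
  have h4 : bellB8 point4 = 2 * √2 := by
    simp [point4, bellB8_toBehaviour, ← four_div_sqrt_two, div_eq_mul_inv]
    ring
  fin_cases i
  exacts [h1, h2, h3, h4, (bellB8_swapBC _).trans h1, (bellB8_swapBC _).trans h2,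
    (bellB8_swapBC _).trans h3, (bellB8_swapBC _).trans h4]

theorem bellB8_familyPoint (α : ℝ) : bellB8 (familyPoint α) = 2 * √2 := by
  simp [familyPoint, bellB8_toBehaviour, ← four_div_sqrt_two]
  ring

/-- The phases of the observables on the GHZ state that generate the family. -/
theorem ghz_qubitExp (r s t : ℝ) (hr : 2 * r * r = 1) (hst : s * s + t * t = 1) :
    -- On the GHZ state a three-body value is the cosine of the sum of the phase angles. With s =
    -- cos α, t = sin α and r = 1/√2 the angles are -π/4, π/4 for Alice, 0, α + π/4 for Bob, and 0,
    -- π/4 - α for Charlie.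
    qubitExp ![⟨r, -r⟩, ⟨r, r⟩] ![1, ⟨(s - t) * r, (s + t) * r⟩] ![1, ⟨(s + t) * r, (s - t) * r⟩]
      (fun i => if i = (0, 0, 0) ∨ i = (1, 1, 1) then (r : ℂ) else 0) =
      { A := fun _ => 0
        B := fun _ => 0
        C := fun _ => 0
        AB := fun _ _ => 0
        AC := fun _ _ => 0
        BC := fun _ _ => 0
        ABC := ![![![r, s], ![s, r]], ![![r, t], ![-t, -r]]] } := by
  simp only [qubitExp, Fin.sum_univ_two, show (1 + 1 : Fin 2) = 0 from rfl, zero_add,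
    Expectations.mk.injEq, funext_iff, Fin.forall_fin_two]
  simp [flipPhase]
  repeat' apply And.intro
  all_goals first
    | linear_combination r * hr
    | linear_combination s * (2 * r * r + 1) * hr
    | linear_combination t * (2 * r * r + 1) * hr
    | linear_combination -t * (2 * r * r + 1) * hr
    | linear_combination r * (s * s + t * t) * (2 * r * r + 1) * hr + r * hst
    | linear_combination -r * (s * s + t * t) * (2 * r * r + 1) * hr - r * hst

theorem ghz_generates (α : ℝ) : ∃ E F G : Fin 2 → Fin 2 → Matrix (Fin 2) (Fin 2) ℂ,
    Generates ghzState E F G (familyPoint α) := by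
  have hr := sqrt_two_inv_spec
  have hst : Real.cos α * Real.cos α + Real.sin α * Real.sin α = 1 := by
    linear_combination Real.cos_sq_add_sin_sq α
  have h := ghz_qubitExp (√2)⁻¹ (Real.cos α) (Real.sin α) hr hst
  have hvec : (fun i : Fin 2 × Fin 2 × Fin 2 =>
      if i = (0, 0, 0) ∨ i = (1, 1, 1) then (((√2)⁻¹ : ℝ) : ℂ) else 0) = ghzVec := by
    funext i
    rw [ghzVec, one_div]
  rw [hvec] at h
  rw [familyPoint, one_div, ← h]
  refine ⟨_, _, _, generates_qubit (fun x => ?_) (normSq_one_cons ?_) (normSq_one_cons ?_) ?_⟩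
  · fin_cases x <;> simp [Complex.normSq_mk] <;> linarith
  · rw [Complex.normSq_mk]
    linear_combination (Real.cos α * Real.cos α + Real.sin α * Real.sin α) * hr + hst
  · rw [Complex.normSq_mk]
    linear_combination (Real.cos α * Real.cos α + Real.sin α * Real.sin α) * hr + hst
  · simp [vecNormSq, ghzVec, Fin.sum_univ_two]
    norm_num

theorem faceHull_subset {P : Behaviour} (hP : P ∈ faceHull) :
    P ∈ quantumSet ∧ bellB8 P = 2 * √2 := by
  have hconv : Convex ℝ {P | P ∈ quantumSet ∧ bellB8 P = 2 * √2} := by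
    rintro P ⟨hP, hP'⟩ Q ⟨hQ, hQ'⟩ a b ha hb hab
    refine ⟨convex_quantumSet hP hQ ha hb hab, ?_⟩
    rw [isLinearMap_bellB8.map_add, isLinearMap_bellB8.map_smul, isLinearMap_bellB8.map_smul, hP',
      hQ', ← add_smul, hab, one_smul]
  refine convexHull_min ?_ hconv hP
  rintro _ (⟨i, rfl⟩ | ⟨α, -, rfl⟩)
  · exact ⟨quantumFinite_subset_quantumSet (points_mem_quantumFinite i), bellB8_points i⟩
  · obtain ⟨E, F, G, h⟩ := ghz_generates α
    exact ⟨quantumFinite_subset_quantumSet ⟨2, _, E, F, G, h⟩, bellB8_familyPoint α⟩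

theorem isGreatest_quantum : IsGreatest (bellB8 '' quantumSet) (2 * √2) := by
  refine ⟨⟨points 0, faceHull_subset (points_mem_faceHull 0)⟩, ?_⟩
  rintro _ ⟨P, hP, rfl⟩
  exact (quantumSet_bellB8_le hP).1

/-! ### The local and no-signalling bounds -/

theorem corr_deterministic {P : Behaviour} {f g h : Fin 2 → Fin 2}
    (hP : ∀ a b c x y z, P a b c x y z = if a = f x ∧ b = g y ∧ c = h z then 1 else 0)
    (x y z : Fin 2) : corr P x y z = sgn (f x) * sgn (g y) * sgn (h z) := by
  simp only [corr, hP]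
  generalize f x = a
  generalize g y = b
  generalize h z = c
  fin_cases a <;> fin_cases b <;> fin_cases c <;> simp [Fin.sum_univ_two, sgn]

theorem isGreatest_local : IsGreatest (bellB8 '' localSet) 2 := by
  constructor
  · refine ⟨fun a b c _ _ _ => if a = 0 ∧ b = 0 ∧ c = 0 then 1 else 0,
      subset_convexHull _ _ ⟨fun _ => 0, fun _ => 0, fun _ => 0, fun _ _ _ _ _ _ => rfl⟩, ?_⟩
    have h := corr_deterministic (P := fun a b c _ _ _ => if a = 0 ∧ b = 0 ∧ c = 0 then 1 else 0)
      (f := fun _ => 0) (g := fun _ => 0) (h := fun _ => 0) fun _ _ _ _ _ _ => rfl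
    simp only [bellB8, h, sgn]
    norm_num
  · rintro _ ⟨P, hP, rfl⟩
    -- The functional is linear, so the bound need only be checked at deterministic points, through
    -- the 64 sign patterns.
    refine convexHull_min ?_ (convex_halfSpace_le isLinearMap_bellB8 2) hP
    rintro P ⟨f, g, h, hP⟩
    have hs : ∀ a : Fin 2, sgn a = 1 ∨ sgn a = -1 := by
      intro a
      fin_cases a <;> simp [sgn]
    simp only [Set.mem_ofPred_eq, bellB8, corr_deterministic hP]
    rcases hs (f 0) with h1 | h1 <;> rcases hs (f 1) with h2 | h2 <;>
      rcases hs (g 0) with h3 | h3 <;> rcases hs (g 1) with h4 | h4 <;>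
      rcases hs (h 0) with h5 | h5 <;> rcases hs (h 1) with h6 | h6 <;>
      rw [h1, h2, h3, h4, h5, h6] <;> norm_num

theorem isGreatest_noSignalling : IsGreatest (bellB8 '' noSignallingSet) 4 := by
  constructor
  -- All four correlators in the functional are algebraically maximal; with vanishing marginals
  -- every probability is 0 or 1/4.
  · refine ⟨Expectations.toBehaviour ⟨fun _ => 0, fun _ => 0, fun _ => 0, fun _ _ => 0,
      fun _ _ => 0, fun _ _ => 0, fun x y z => if x = 1 ∧ y = 1 ∧ z = 1 then -1 else 1⟩,
      ⟨?_, ?_, ?_, ?_, ?_⟩, ?_⟩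
    · intro a b c x y z
      have hs : ∀ a : Fin 2, sgn a = 1 ∨ sgn a = -1 := by
        intro a
        fin_cases a <;> simp [sgn]
      simp only [Expectations.toBehaviour]
      rcases hs a with h1 | h1 <;> rcases hs b with h2 | h2 <;> rcases hs c with h3 | h3 <;>
        rw [h1, h2, h3] <;> split_ifs <;> norm_num
    · intro x y z
      exact ((hasExpectations_iff _ _).2 rfl x y z).1
    · intro b c x x' y z
      simp only [Expectations.toBehaviour, Fin.sum_univ_two, sgn, Fin.val_zero, Fin.val_one,
        pow_zero, pow_one]
      ring
    · intro b c x x' y z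
      simp only [Expectations.toBehaviour, Fin.sum_univ_two, sgn, Fin.val_zero, Fin.val_one,
        pow_zero, pow_one]
      ring
    · intro b c x x' y z
      simp only [Expectations.toBehaviour, Fin.sum_univ_two, sgn, Fin.val_zero, Fin.val_one,
        pow_zero, pow_one]
      ring
    · rw [bellB8_toBehaviour]
      norm_num
  · rintro _ ⟨P, ⟨h0, h1, -⟩, rfl⟩
    have hc : ∀ x y z, corr P x y z ≤ 1 ∧ -1 ≤ corr P x y z := by
      intro x y z
      have e := h1 x y z
      simp only [Fin.sum_univ_two] at e
      have p := h0 0 0 0 x y z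
      have p1 := h0 0 0 1 x y z
      have p2 := h0 0 1 0 x y z
      have p3 := h0 0 1 1 x y z
      have p4 := h0 1 0 0 x y z
      have p5 := h0 1 0 1 x y z
      have p6 := h0 1 1 0 x y z
      have p7 := h0 1 1 1 x y z
      simp only [corr, Fin.sum_univ_two, sgn, Fin.val_zero, Fin.val_one, pow_zero, pow_one]
      constructor <;> linarith
    have e1 := (hc 0 0 0).1
    have e2 := (hc 0 1 1).1
    have e3 := (hc 1 0 0).1
    have e4 := (hc 1 1 1).2
    simp only [bellB8]
    linarith

end

end Tripartite

theorem mainTheorem6 :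
    IsGreatest (Tripartite.bellB8 '' Tripartite.localSet) 2 ∧
    IsGreatest (Tripartite.bellB8 '' Tripartite.quantumSet) (2 * √2) ∧
    IsGreatest (Tripartite.bellB8 '' Tripartite.noSignallingSet) 4 ∧
    Tripartite.face Tripartite.bellB8 Tripartite.quantumSet =
      convexHull ℝ (Set.range Tripartite.points ∪
        Tripartite.familyPoint '' Set.Icc 0 (2 * Real.pi)) ∧
    ∀ α ∈ Set.Icc 0 (2 * Real.pi),
      ∃ E F G : Fin 2 → Fin 2 → Matrix (Fin 2) (Fin 2) ℂ,
        Tripartite.Generates Tripartite.ghzState E F G (Tripartite.familyPoint α) := by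
  refine ⟨Tripartite.isGreatest_local, Tripartite.isGreatest_quantum,
    Tripartite.isGreatest_noSignalling, ?_, fun α _ => Tripartite.ghz_generates α⟩
  ext P
  simp only [Tripartite.face, Tripartite.maxValue, Tripartite.isGreatest_quantum.csSup_eq]
  exact ⟨fun h => (Tripartite.quantumSet_bellB8_le h.1).2 h.2, Tripartite.faceHull_subset⟩
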